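/- Let $\mathbb T^N=\mathbb R^N/\mathbb Z^N$ and let $L:\mathbb T^N\times\mathbb R^N\to\mathbb R$ be continuous and $C^2$ in $v$, such that 1. $L(x,v)/|v|\to+\infty$ as $|v|\to\infty$, uniformly in $x$; 2. the Hessian $\partial^2L/\partial v_i\partial v_j(x,v)$ is positive definite for all $(x,v)$; 3. there are constants $C,\Gamma>0$ with $L(x+y,v-z)+L(x-y,v+z)-2L(x,v)\le C|y|^2+\Gamma|z|^2$ for all $x\in\mathbb T^N$ and $v,y,z\in\mathbb R^N$. Fix $h>0$. For $\epsilon>0$ and $\phi\in C(\mathbb T^N)$ put $$\mathcal G[\phi](x)=-\epsilon h\ln\int_{\mathbb R^N}e^{-\frac{hL(x,v)+\phi(x+hv)}{\epsilon h}}\,dv,\qquad \bar{\mathcal G}[\phi](x)=-\epsilon h\ln\int_{\mathbb R^N}e^{-\frac{hL(x-hv,v)+\phi(x-hv)}{\epsilon h}}\,dv .$$ For each $\epsilon>0$ let $\phi_{\epsilon,h},\bar\phi_{\epsilon,h}\in C(\mathbb T^N)$ and $\lambda_{\epsilon,h}\in\mathbb R$ satisfy $\mathcal G[\phi_{\epsilon,h}]=\phi_{\epsilon,h}+\lambda_{\epsilon,h}$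 and $\bar{\mathcal G}[\bar\phi_{\epsilon,h}]=\bar\phi_{\epsilon,h}+\lambda_{\epsilon,h}$, normalized by $\phi_{\epsilon,h}(0)=0$ and $\int_{\mathbb T^N}e^{-(\bar\phi_{\epsilon,h}+\phi_{\epsilon,h})/(\epsilon h)}dx=1$. Let $\mu_{\epsilon,h}$ be the measure on $\mathbb T^N\times\mathbb R^N$ with density $$\mu_{\epsilon,h}(x,v)=e^{-\frac{\bar\phi_{\epsilon,h}(x)+\phi_{\epsilon,h}(x)}{\epsilon h}}\;e^{-\frac{hL(x,v)+\phi_{\epsilon,h}(x+hv)-\phi_{\epsilon,h}(x)-\lambda_{\epsilon,h}}{\epsilon h}} ,$$ let $$\overline H_{\epsilon,h}=\int L\,d\mu_{\epsilon,h}+\epsilon\int\mu_{\epsilon,h}(x,v)\ln\frac{\mu_{\epsilon,h}(x,v)}{\int_{\mathbb R^N}\mu_{\epsilon,h}(x,w)\,dw}\,dx\,dv ,$$ $$f_{\epsilon,h}(x,v)=\frac{\bar\phi_{\epsilon,h}(x)+\phi_{\epsilon,h}(x)}h+L(x,v)+\frac{\phi_{\epsilon,h}(x+hv)-\phi_{\epsilon,h}(x)}h-\overline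 H_{\epsilon,h} ,$$ and let $\overline H_h$ be the infimum of $\int L\,d\mu$ over the Borel probability measures $\mu$ on $\mathbb T^N\times\mathbb R^N$ such that $\int(\varphi(x+hv)-\varphi(x))\,d\mu=0$ for all $\varphi\in C(\mathbb T^N)$. For $\phi_h,\bar\phi_h\in C(\mathbb T^N)$ put $$I_h(x,v)=\frac{\bar\phi_h(x)+\phi_h(x+hv)}h+L(x,v)-\overline H_h .$$ Then, with values in $[-\infty,+\infty]$, $\ln 0=-\infty$ and $\inf_\emptyset=+\infty$: (i) $\mu_{\epsilon,h}(A)=\int_Ae^{-f_{\epsilon,h}(x,v)/\epsilon}\,dx\,dv$ for every $\epsilon>0$ and every Borel set $A\subset\mathbb T^N\times\mathbb R^N$. (ii) Every sequence $\epsilon_k\to0^+$ has a subsequence along which $\phi_{\epsilon_k,h}$ and $\bar\phi_{\epsilon_k,h}$ converge uniformly. (iii) If $\epsilon_k\to0^+$ and $\phi_{\epsilon_k,h}\to\phi_h$, $\bar\phi_{\epsilon_k,h}\to\bar\phi_h$ uniformly, then $$\limsup_{k\to\infty}\epsilon_k\ln\mu_{\epsilon_k,h}(A)\le-\inf_AI_h\quad\text{for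 every closed bounded }A\subset\mathbb T^N\times\mathbb R^N,$$ $$\liminf_{k\to\infty}\epsilon_k\ln\mu_{\epsilon_k,h}(A)\ge-\inf_AI_h\quad\text{for every open bounded }A\subset\mathbb T^N\times\mathbb R^N.$$ (iv) Suppose that the continuous solutions $u$ of $u(x)=\inf_v\{u(x+hv)+hL(x,v)-h\overline H_h\}$ are unique up to an additive constant, and likewise those of $u(x)=\inf_v\{u(x-hv)+hL(x-hv,v)-h\overline H_h\}$. Then $\phi_{\epsilon,h}$ and $\bar\phi_{\epsilon,h}$ converge uniformly to some $\phi_h$ and $\bar\phi_h$ as $\epsilon\to0^+$, and $$\limsup_{\epsilon\to0^+}\epsilon\ln\mu_{\epsilon,h}(A)\le-\inf_AI_h\ \ (A\text{ closed and bounded}),\qquad \liminf_{\epsilon\to0^+}\epsilon\ln\mu_{\epsilon,h}(A)\ge-\inf_AI_h\ \ (A\text{ open and bounded}).$$ -/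

import Mathlib

open MeasureTheory Filter Topology

noncomputable section

namespace EntropyMather

/-- The flat torus `𝕋^N = ℝ^N / ℤ^N`; its `volume` is Lebesgue measure, of total mass one. -/
abbrev Torus (N : ℕ) : Type := UnitAddTorus (Fin N)

/-- The space `ℝ^N` of velocities, with the Euclidean norm and Lebesgue measure. -/
abbrev Vel (N : ℕ) : Type := EuclideanSpace ℝ (Fin N)

variable {N : ℕ}

/-- The canonical projection `ℝ^N → 𝕋^N`. For `x : Torus N` and `w : Vel N`, the point written
`x + w` in the mathematics is `x + proj w`. -/
def proj (w : Vel N) : Torus N := fun i => ((w i : ℝ) : UnitAddCircle)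

/-- The standing hypotheses on the Lagrangian `L(x, v)`, which is `ℤ^N`-periodic in `x`, that is,
defined on `𝕋^N × ℝ^N`. -/
structure IsLagrangian (L : Torus N → Vel N → ℝ) : Prop where
  continuous : Continuous fun p : Torus N × Vel N => L p.1 p.2
  /-- `L(x, v) / |v| → +∞` as `|v| → ∞`, uniformly in `x`. -/
  superlinear : ∀ M : ℝ, ∃ R : ℝ, ∀ (x : Torus N) (v : Vel N), R < ‖v‖ → M < L x v / ‖v‖
  contDiff : ∀ x : Torus N, ContDiff ℝ 2 (L x)
  /-- The Hessian of `L` in `v` is positive definite. -/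
  hessian_pos : ∀ (x : Torus N) (v w : Vel N), w ≠ 0 → 0 < iteratedFDeriv ℝ 2 (L x) v ![w, w]
  /-- Uniform semiconcavity. -/
  semiconcave : ∃ C Γ : ℝ, 0 < C ∧ 0 < Γ ∧ ∀ (x : Torus N) (v y z : Vel N),
    L (x + proj y) (v - z) + L (x - proj y) (v + z) - 2 * L x v ≤ C * ‖y‖ ^ 2 + Γ * ‖z‖ ^ 2

/-- The operator `𝒢[φ](x) = -εh ln ∫ exp (-(h L(x,v) + φ(x+hv)) / (εh)) dv`. -/
def opG (L : Torus N → Vel N → ℝ) (ε h : ℝ) (φ : C(Torus N, ℝ)) (x : Torus N) : ℝ :=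
  -(ε * h) * Real.log
    (∫ v : Vel N, Real.exp (-((h * L x v + φ (x + proj (h • v))) / (ε * h))))

/-- The operator `𝒢̄[φ](x) = -εh ln ∫ exp (-(h L(x-hv,v) + φ(x-hv)) / (εh)) dv`. -/
def opGbar (L : Torus N → Vel N → ℝ) (ε h : ℝ) (φ : C(Torus N, ℝ)) (x : Torus N) : ℝ :=
  -(ε * h) * Real.log
    (∫ v : Vel N, Real.exp
      (-((h * L (x - proj (h • v)) v + φ (x - proj (h • v))) / (ε * h))))

/-- `(φ, φ̄, l)` solves `𝒢[φ] = φ + l` and `𝒢̄[φ̄] = φ̄ + l`, and the two additive constants are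
fixed by `φ(0) = 0` and `∫ exp (-(φ̄ + φ) / (εh)) dx = 1`. -/
structure IsNormalizedFixedPair (L : Torus N → Vel N → ℝ) (ε h : ℝ)
    (φ φbar : C(Torus N, ℝ)) (l : ℝ) : Prop where
  forward : ∀ x, opG L ε h φ x = φ x + l
  backward : ∀ x, opGbar L ε h φbar x = φbar x + l
  zero : φ 0 = 0
  normalized : ∫ x : Torus N, Real.exp (-((φbar x + φ x) / (ε * h))) = 1

/-- The density of `μ_{ε,h}`: `θ(x) exp (-(h L(x,v) + φ(x+hv) - φ(x) - l) / (εh))`, where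
`θ(x) = exp (-(φ̄(x) + φ(x)) / (εh))`. -/
def density (L : Torus N → Vel N → ℝ) (ε h : ℝ) (φ φbar : C(Torus N, ℝ)) (l : ℝ)
    (p : Torus N × Vel N) : ℝ :=
  Real.exp (-((φbar p.1 + φ p.1) / (ε * h))) *
    Real.exp (-((h * L p.1 p.2 + φ (p.1 + proj (h • p.2)) - φ p.1 - l) / (ε * h)))

/-- The measure `μ_{ε,h}` on `𝕋^N × ℝ^N`. -/
def entropyMeasure (L : Torus N → Vel N → ℝ) (ε h : ℝ) (φ φbar : C(Torus N, ℝ)) (l : ℝ) :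
    Measure (Torus N × Vel N) :=
  volume.withDensity fun p => ENNReal.ofReal (density L ε h φ φbar l p)

/-- The entropy `S[μ] = ∫ μ(x,v) ln (μ(x,v) / ∫ μ(x,w) dw) dx dv` of a density. -/
def entropy (m : Torus N × Vel N → ℝ) : ℝ :=
  ∫ p : Torus N × Vel N, m p * Real.log (m p / ∫ w : Vel N, m (p.1, w))

/-- `H̄_{ε,h} = ∫ L dμ_{ε,h} + ε S[μ_{ε,h}]`. -/
def penalizedAction (L : Torus N → Vel N → ℝ) (ε h : ℝ) (φ φbar : C(Torus N, ℝ)) (l : ℝ) : ℝ :=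
  (∫ p, L p.1 p.2 ∂(entropyMeasure L ε h φ φbar l)) + ε * entropy (density L ε h φ φbar l)

/-- `f_{ε,h}(x,v) = (φ̄(x)+φ(x))/h + L(x,v) + (φ(x+hv)-φ(x))/h - H̄_{ε,h}`. -/
def penalizedRate (L : Torus N → Vel N → ℝ) (ε h : ℝ) (φ φbar : C(Torus N, ℝ)) (l : ℝ)
    (p : Torus N × Vel N) : ℝ :=
  (φbar p.1 + φ p.1) / h + L p.1 p.2 + (φ (p.1 + proj (h • p.2)) - φ p.1) / h
    - penalizedAction L ε h φ φbar l

/-- The discrete holonomic probability measures `ℳ_h`. -/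
structure IsHolonomic (h : ℝ) (μ : Measure (Torus N × Vel N)) : Prop where
  isProbabilityMeasure : IsProbabilityMeasure μ
  holonomic : ∀ φ : C(Torus N, ℝ), ∫ p, (φ (p.1 + proj (h • p.2)) - φ p.1) ∂μ = 0

/-- `H̄_h`: the least action `∫ L dμ` over the discrete holonomic measures. As `L` is bounded below,
the measures for which `L` is not integrable have action `+∞` and do not contribute. -/
def criticalValue (L : Torus N → Vel N → ℝ) (h : ℝ) : ℝ :=
  sInf {a : ℝ | ∃ μ : Measure (Torus N × Vel N), IsHolonomic h μ ∧
    Integrable (fun p => L p.1 p.2) μ ∧ a = ∫ p, L p.1 p.2 ∂μ}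

/-- Calibrated (forward) subactions: `u(x) = inf_v {u(x+hv) + h L(x,v) - h H̄_h}`. -/
def IsCalibratedForward (L : Torus N → Vel N → ℝ) (h : ℝ) (u : C(Torus N, ℝ)) : Prop :=
  ∀ x : Torus N, IsGLB
    (Set.range fun v : Vel N => u (x + proj (h • v)) + h * L x v - h * criticalValue L h) (u x)

/-- Calibrated backward subactions: `u(x) = inf_v {u(x-hv) + h L(x-hv,v) - h H̄_h}`. -/
def IsCalibratedBackward (L : Torus N → Vel N → ℝ) (h : ℝ) (u : C(Torus N, ℝ)) : Prop :=
  ∀ x : Torus N, IsGLB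
    (Set.range fun v : Vel N =>
      u (x - proj (h • v)) + h * L (x - proj (h • v)) v - h * criticalValue L h) (u x)

/-- Any two functions with the property `P` differ by a constant. -/
def UniqueUpToConst (P : C(Torus N, ℝ) → Prop) : Prop :=
  ∀ u u' : C(Torus N, ℝ), P u → P u' → ∃ c : ℝ, ∀ x, u x = u' x + c

/-- The rate function `I_h(x,v) = (φ̄_h(x) + φ_h(x+hv))/h + L(x,v) - H̄_h`. -/
def rate (L : Torus N → Vel N → ℝ) (h : ℝ) (φ φbar : C(Torus N, ℝ)) (p : Torus N × Vel N) : ℝ :=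
  (φbar p.1 + φ (p.1 + proj (h • p.2))) / h + L p.1 p.2 - criticalValue L h

/-- The large deviation bounds on closed bounded and on open bounded sets, with speed `1 / ε` and
rate function `I`, along a filter. In `[-∞, +∞]`, `ln 0 = -∞` and the infimum over `∅` is `+∞`. -/
def LargeDeviationBounds {ι : Type} (l : Filter ι) (ε : ι → ℝ)
    (μ : ι → Measure (Torus N × Vel N)) (I : Torus N × Vel N → ℝ) : Prop :=
  (∀ A : Set (Torus N × Vel N), IsClosed A → Bornology.IsBounded A →
    limsup (fun i => (ε i : EReal) * ENNReal.log (μ i A)) l ≤ -(⨅ p ∈ A, (I p : EReal))) ∧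
  (∀ A : Set (Torus N × Vel N), IsOpen A → Bornology.IsBounded A →
    -(⨅ p ∈ A, (I p : EReal)) ≤ liminf (fun i => (ε i : EReal) * ENNReal.log (μ i A)) l)

end EntropyMather

end

/-!
The proof rests on compactness of the fixed points and on Laplace's principle.

Shifting the velocity by `∓ y / h` in the integral defining `𝒢[φ](x ± y)` keeps the endpoint
`x + hv` in place, so the Cauchy–Schwarz inequality (`two_mul_log_integral_exp_le`) transfers the
semiconcavity of `L` to `φ_{ε,h}`, and similarly to `φ̄_{ε,h}`, with a constant independent of `ε`.
On the torus this bounds the oscillation and the modulus of continuity, and with the two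
normalizations the Arzelà–Ascoli theorem applies (`exists_isCompact_of_isNormalizedFixedPair`).

The forward and backward equations say that both `x` and `x + hv` have law
`θ = exp (-(φ̄ + φ) / (εh))` under `μ_{ε,h}`, which is therefore a holonomic probability measure
(`isHolonomic_entropyMeasure`). In the entropy the coboundary `φ (x + hv) - φ (x)` then integrates
to zero, and `H̄_{ε,h} = λ_{ε,h} / h` (`penalizedAction_eq`), which gives the formula for `μ_{ε,h}`.

Along every family for which the fixed points converge, `λ_{ε,h}` tends to `h H̄_h`
(`tendsto_eigenvalue`). From below, `μ_{ε,h}` competes in the definition of `H̄_h`, and Gibbs'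
inequality controls its entropy. From above, a holonomic measure of nearly minimal action provides
one point `(x, v)` at which Laplace's principle is applied. Hence `f_{ε,h} → I_h` uniformly on
`𝕋^N × ℝ^N` (`tendstoUniformly_penalizedRate`), and the large deviation bounds follow by estimating
`∫_A exp (-f_{ε,h} / ε)` directly.

Laplace's principle in the fixed point equations (`isGLB_of_tendsto_neg_mul_log_integral_exp`) shows
that limits of `φ_{ε,h}` and `φ̄_{ε,h}` are calibrated, and in the normalization it gives
`min (φ̄_h + φ_h) = 0`. When calibrated subactions are unique up to constants, these facts and
`φ_h (0) = 0` leave a single possible limit (`limit_unique`), so the whole families converge.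
-/

noncomputable section

namespace EntropyMather

/-! ### Laplace asymptotics -/

lemma integrable_exp_neg_mul_norm {E : Type*} [NormedAddCommGroup E] [NormedSpace ℝ E]
    [FiniteDimensional ℝ E] [MeasurableSpace E] [BorelSpace E] (ν : Measure E)
    [ν.IsAddHaarMeasure] {a : ℝ} (ha : 0 < a) :
    Integrable (fun v : E => Real.exp (-(a * ‖v‖))) ν := by
  set n : ℕ := Module.finrank ℝ E + 1
  have hr : ((Module.finrank ℝ E : ℕ) : ℝ) < (n : ℝ) := by simp [n]
  refine ((integrable_one_add_norm (μ := ν) hr).const_mul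
    (Real.exp a * (n.factorial / a ^ n))).mono' (by fun_prop) (.of_forall fun v => ?_)
  have hs : 0 < 1 + ‖v‖ := by positivity
  have hexp := Real.pow_div_factorial_le_exp (a * (1 + ‖v‖)) (by positivity) n
  have hfac : (0 : ℝ) < n.factorial := by positivity
  have hpow : 0 < (a * (1 + ‖v‖)) ^ n / n.factorial := by positivity
  rw [Real.norm_of_nonneg (Real.exp_pos _).le, Real.rpow_neg hs.le, Real.rpow_natCast]
  calc Real.exp (-(a * ‖v‖)) = Real.exp a * (Real.exp (a * (1 + ‖v‖)))⁻¹ := by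
        rw [← Real.exp_neg, ← Real.exp_add]; ring_nf
    _ ≤ Real.exp a * ((a * (1 + ‖v‖)) ^ n / n.factorial)⁻¹ := by gcongr
    _ = _ := by rw [mul_pow]; field_simp

/-- Midpoint convexity of `c ↦ log ∫ exp c`, with an error: a form of the Cauchy–Schwarz
inequality. -/
lemma two_mul_log_integral_exp_le {α : Type*} [MeasurableSpace α] {ν : Measure α} [NeZero ν]
    {a b c : α → ℝ} {K : ℝ} (ha : Integrable (fun x => Real.exp (a x)) ν)
    (hb : Integrable (fun x => Real.exp (b x)) ν) (hc : Integrable (fun x => Real.exp (c x)) ν)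
    (hle : ∀ x, 2 * c x ≤ a x + b x + K) :
    2 * Real.log (∫ x, Real.exp (c x) ∂ν) ≤
      Real.log (∫ x, Real.exp (a x) ∂ν) + Real.log (∫ x, Real.exp (b x) ∂ν) + K := by
  have hA := integral_exp_pos ha
  have hB := integral_exp_pos hb
  have hC := integral_exp_pos hc
  set A := ∫ x, Real.exp (a x) ∂ν
  set B := ∫ x, Real.exp (b x) ∂ν
  set C := ∫ x, Real.exp (c x) ∂ν
  set s := (Real.log A + Real.log B + K) / 2 with hs
  -- After normalising both integrals to one, this is the pointwise inequality between the
  -- geometric and the arithmetic mean.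
  have hpt : ∀ x, Real.exp (c x) ≤
      Real.exp s * (Real.exp (a x) * (2 * A)⁻¹ + Real.exp (b x) * (2 * B)⁻¹) := by
    intro x
    have h1 : Real.exp (a x) * (2 * A)⁻¹ = Real.exp ((a x - Real.log A) / 2) ^ 2 / 2 := by
      rw [← Real.exp_nat_mul, Nat.cast_ofNat, mul_div_cancel₀ _ two_ne_zero, Real.exp_sub,
        Real.exp_log hA]
      field_simp
    have h2 : Real.exp (b x) * (2 * B)⁻¹ = Real.exp ((b x - Real.log B) / 2) ^ 2 / 2 := by
      rw [← Real.exp_nat_mul, Nat.cast_ofNat, mul_div_cancel₀ _ two_ne_zero, Real.exp_sub,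
        Real.exp_log hB]
      field_simp
    have h3 : Real.exp (c x) ≤ Real.exp s * (Real.exp ((a x - Real.log A) / 2) *
        Real.exp ((b x - Real.log B) / 2)) := by
      rw [← Real.exp_add, ← Real.exp_add]
      refine Real.exp_le_exp.2 ?_
      rw [hs]; linarith [hle x]
    refine h3.trans (mul_le_mul_of_nonneg_left ?_ (Real.exp_pos _).le)
    rw [h1, h2]
    nlinarith [sq_nonneg (Real.exp ((a x - Real.log A) / 2) - Real.exp ((b x - Real.log B) / 2))]
  have hint : C ≤ Real.exp s := by
    calc C ≤ ∫ x, Real.exp s * (Real.exp (a x) * (2 * A)⁻¹ + Real.exp (b x) * (2 * B)⁻¹) ∂ν :=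
          integral_mono hc (((ha.mul_const _).add (hb.mul_const _)).const_mul _) hpt
      _ = Real.exp s * (A * (2 * A)⁻¹ + B * (2 * B)⁻¹) := by
          rw [integral_const_mul, integral_add (ha.mul_const _) (hb.mul_const _),
            integral_mul_const, integral_mul_const]
      _ = Real.exp s := by field_simp; norm_num
  have := (Real.log_le_iff_le_exp hC).2 hint
  linarith

lemma eventually_forall_abs_sub_lt {Y ι : Type*} {l : Filter ι} {F : ι → Y → ℝ} {G : Y → ℝ}
    (hFG : TendstoUniformly F G l) {δ : ℝ} (hδ : 0 < δ) :
    ∀ᶠ i in l, ∀ y, |F i y - G y| < δ := by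
  filter_upwards [Metric.tendstoUniformly_iff.1 hFG δ hδ] with i hi y
  rw [abs_sub_comm]; exact hi y

section Laplace

variable {Y ι : Type*} [MeasurableSpace Y] {ν : Measure Y}
  {l : Filter ι} {e : ι → ℝ} {F : ι → Y → ℝ} {G : Y → ℝ}

lemma eventually_neg_mul_log_integral_exp_le [TopologicalSpace Y] [BorelSpace Y]
    [ν.IsOpenPosMeasure] [IsLocallyFiniteMeasure ν]
    (he : Tendsto e l (𝓝[>] 0)) (hG : Continuous G) (hFG : TendstoUniformly F G l)
    (hint : ∀ᶠ i in l, Integrable (fun y => Real.exp (-(F i y / e i))) ν) (y : Y) {δ : ℝ}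
    (hδ : 0 < δ) :
    ∀ᶠ i in l, -(e i) * Real.log (∫ z, Real.exp (-(F i z / e i)) ∂ν) ≤ G y + δ := by
  obtain ⟨U, hyU, hUo, hUfin⟩ := ν.exists_isOpen_measure_lt_top y
  set B := U ∩ {z | G z < G y + δ / 3}
  have hBo : IsOpen B := hUo.inter (isOpen_lt hG continuous_const)
  have hBfin : ν B < ⊤ := (measure_mono Set.inter_subset_left).trans_lt hUfin
  have hyB : y ∈ B := ⟨hyU, lt_add_of_pos_right (G y) (by positivity : 0 < δ / 3)⟩
  have hBpos : 0 < ν.real B :=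
    ENNReal.toReal_pos (hBo.measure_pos ν ⟨y, hyB⟩).ne' hBfin.ne
  have he0 : Tendsto (fun i => -(e i) * Real.log (ν.real B)) l (𝓝 0) := by
    simpa using ((he.mono_right nhdsWithin_le_nhds).neg.mul_const (Real.log (ν.real B)))
  filter_upwards [eventually_forall_abs_sub_lt hFG (δ := δ / 3) (by linarith), hint,
    he.eventually self_mem_nhdsWithin, he0.eventually (gt_mem_nhds (by linarith : 0 < δ / 3))]
    with i hi hinti hei hlog
  have hei : 0 < e i := hei
  have hlow : ν.real B * Real.exp (-((G y + 2 * (δ / 3)) / e i)) ≤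
      ∫ z, Real.exp (-(F i z / e i)) ∂ν := by
    calc ν.real B * Real.exp (-((G y + 2 * (δ / 3)) / e i))
        = ∫ _ in B, Real.exp (-((G y + 2 * (δ / 3)) / e i)) ∂ν := by
          rw [setIntegral_const, smul_eq_mul]
      _ ≤ ∫ z in B, Real.exp (-(F i z / e i)) ∂ν := by
          refine setIntegral_mono_on (integrableOn_const hBfin.ne) hinti.integrableOn
            hBo.measurableSet fun z hz => ?_
          have h1 := (abs_lt.1 (hi z)).2
          have h2 : G z < G y + δ / 3 := hz.2
          gcongr
          linarith
      _ ≤ _ := setIntegral_le_integral hinti (.of_forall fun _ => (Real.exp_pos _).le)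
  have hl := Real.log_le_log (by positivity) hlow
  rw [Real.log_mul hBpos.ne' (Real.exp_pos _).ne', Real.log_exp] at hl
  have hm := mul_le_mul_of_nonneg_left hl hei.le
  have hcan : e i * (-((G y + 2 * (δ / 3)) / e i)) = -(G y + 2 * (δ / 3)) := by field_simp
  rw [mul_add, hcan] at hm
  linarith

lemma eventually_le_neg_mul_log_integral_exp [NeZero ν] (he : Tendsto e l (𝓝[>] 0))
    (hFG : TendstoUniformly F G l)
    (hint : ∀ᶠ i in l, Integrable (fun y => Real.exp (-(F i y / e i))) ν)
    (hG1 : Integrable (fun y => Real.exp (-G y)) ν) {m δ : ℝ} (hm : ∀ y, m ≤ G y) (hδ : 0 < δ) :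
    ∀ᶠ i in l, m - δ ≤ -(e i) * Real.log (∫ z, Real.exp (-(F i z / e i)) ∂ν) := by
  have hJ := integral_exp_pos hG1
  set J := ∫ y, Real.exp (-G y) ∂ν
  set η := δ / 2 with hη
  have he' := he.mono_right nhdsWithin_le_nhds
  have hlim : Tendsto (fun i => (m - η) * (1 - e i) - e i * (η + Real.log J)) l (𝓝 (m - η)) := by
    simpa using ((he'.const_sub 1).const_mul (m - η)).sub (he'.mul_const (η + Real.log J))
  filter_upwards [eventually_forall_abs_sub_lt hFG (δ := η) (by positivity), hint,
    he.eventually self_mem_nhdsWithin, he'.eventually (gt_mem_nhds zero_lt_one),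
    hlim.eventually (lt_mem_nhds (by rw [hη]; linarith : m - δ < m - η))]
    with i hi hinti hei hei1 hfin
  have hei : 0 < e i := hei
  -- All but one unit of the factor `1 / e i` is spent on the bound `m`, and the remaining unit
  -- keeps the integral finite.
  have hupp : ∫ z, Real.exp (-(F i z / e i)) ∂ν ≤
      Real.exp (-((m - η) * (1 / e i - 1)) + η) * J := by
    rw [← integral_const_mul]
    refine integral_mono hinti (hG1.const_mul _) fun z => ?_
    simp only
    rw [← Real.exp_add]
    refine Real.exp_le_exp.2 ?_
    have h1 := (abs_lt.1 (hi z)).1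
    have h2 : 0 ≤ 1 / e i - 1 := by
      rw [sub_nonneg, le_div_iff₀ hei]; linarith
    have h3 : F i z / e i = F i z * (1 / e i - 1) + F i z := by ring
    have h4 : (m - η) * (1 / e i - 1) ≤ F i z * (1 / e i - 1) :=
      mul_le_mul_of_nonneg_right (by linarith [hm z]) h2
    rw [h3]; linarith
  have hl := Real.log_le_log (integral_exp_pos hinti) hupp
  rw [Real.log_mul (Real.exp_pos _).ne' hJ.ne', Real.log_exp] at hl
  have hm' := mul_le_mul_of_nonneg_left hl hei.le
  have hcan : e i * (-((m - η) * (1 / e i - 1)) + η + Real.log J) =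
      -((m - η) * (1 - e i)) + e i * (η + Real.log J) := by field_simp; ring
  rw [hcan] at hm'
  linarith

/-- Laplace's principle: the limit of `-ε log ∫ exp (-F_ε / ε)` is the infimum of `lim F_ε`. -/
lemma isGLB_of_tendsto_neg_mul_log_integral_exp [TopologicalSpace Y] [BorelSpace Y]
    [ν.IsOpenPosMeasure] [IsLocallyFiniteMeasure ν] [NeZero ν] [l.NeBot]
    (he : Tendsto e l (𝓝[>] 0)) (hG : Continuous G)
    (hFG : TendstoUniformly F G l)
    (hint : ∀ᶠ i in l, Integrable (fun y => Real.exp (-(F i y / e i))) ν)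
    (hG1 : Integrable (fun y => Real.exp (-G y)) ν) {c : ℝ}
    (hc : Tendsto (fun i => -(e i) * Real.log (∫ z, Real.exp (-(F i z / e i)) ∂ν)) l (𝓝 c)) :
    IsGLB (Set.range G) c := by
  refine ⟨?_, fun m hm => ?_⟩
  · rintro _ ⟨y, rfl⟩
    exact le_of_forall_pos_le_add fun δ hδ =>
      le_of_tendsto hc (eventually_neg_mul_log_integral_exp_le he hG hFG hint y hδ)
  · have hm' : ∀ y, m ≤ G y := fun y => hm ⟨y, rfl⟩
    refine le_of_forall_sub_le fun δ hδ =>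
      ge_of_tendsto hc (eventually_le_neg_mul_log_integral_exp he hFG hint hG1 hm' hδ)

/-- Upper large deviation bound on compact sets for measures `exp (-F_ε / ε) ν` with `F_ε`
uniformly convergent. -/
lemma limsup_mul_log_setLIntegral_exp_le [TopologicalSpace Y] [IsFiniteMeasureOnCompacts ν]
    (he : Tendsto e l (𝓝[>] 0)) (hG : Continuous G) (hFG : TendstoUniformly F G l) {A : Set Y}
    (hA : IsCompact A) :
    limsup (fun i => (e i : EReal) *
      ENNReal.log (∫⁻ y in A, ENNReal.ofReal (Real.exp (-(F i y / e i))) ∂ν)) l ≤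
      -(⨅ y ∈ A, (G y : EReal)) := by
  rcases A.eq_empty_or_nonempty with rfl | hne
  · refine limsup_le_of_le (h := ?_)
    filter_upwards [he.eventually self_mem_nhdsWithin] with i hi
    have hi : 0 < e i := hi
    simp [EReal.coe_mul_bot_of_pos hi]
  obtain ⟨y₀, hy₀, hmin⟩ := hA.exists_isMinOn hne hG.continuousOn
  have hinf : (⨅ y ∈ A, (G y : EReal)) = (G y₀ : EReal) :=
    le_antisymm (iInf₂_le y₀ hy₀) (le_iInf₂ fun y hy => EReal.coe_le_coe_iff.2 (hmin hy))
  rw [hinf, ← EReal.coe_neg]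
  refine EReal.le_of_forall_lt_iff_le.1 fun z hz => ?_
  have hz : -G y₀ < z := by exact_mod_cast hz
  set δ := (z + G y₀) / 2 with hδ
  have hδ0 : 0 < δ := by rw [hδ]; linarith
  refine limsup_le_of_le (h := ?_)
  have he0 : Tendsto (fun i => e i * Real.log (ν.real A + 1)) l (𝓝 0) := by
    simpa using (he.mono_right nhdsWithin_le_nhds).mul_const (Real.log (ν.real A + 1))
  filter_upwards [eventually_forall_abs_sub_lt hFG hδ0, he.eventually self_mem_nhdsWithin,
    he0.eventually (gt_mem_nhds hδ0)] with i hi hei hlog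
  have hei : 0 < e i := hei
  have hAr : 0 ≤ ν.real A := measureReal_nonneg
  have hle : ∫⁻ y in A, ENNReal.ofReal (Real.exp (-(F i y / e i))) ∂ν ≤
      ENNReal.ofReal (Real.exp (z / e i)) := by
    calc ∫⁻ y in A, ENNReal.ofReal (Real.exp (-(F i y / e i))) ∂ν
        ≤ ∫⁻ _ in A, ENNReal.ofReal (Real.exp (-((G y₀ - δ) / e i))) ∂ν := by
          refine setLIntegral_mono measurable_const fun y hy => ?_
          have h1 := (abs_lt.1 (hi y)).1
          have h2 : G y₀ ≤ G y := hmin hy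
          refine ENNReal.ofReal_le_ofReal ?_
          gcongr
          linarith
      _ = ENNReal.ofReal (Real.exp (-((G y₀ - δ) / e i)) * ν.real A) := by
          rw [setLIntegral_const, ENNReal.ofReal_mul (Real.exp_pos _).le,
            ofReal_measureReal hA.measure_lt_top.ne]
      _ ≤ _ := by
          refine ENNReal.ofReal_le_ofReal ?_
          calc Real.exp (-((G y₀ - δ) / e i)) * ν.real A
              ≤ Real.exp (-((G y₀ - δ) / e i)) * Real.exp (δ / e i) := by
                gcongr
                refine (le_add_of_nonneg_right zero_le_one).trans
                  ((Real.log_le_iff_le_exp (by positivity)).1 ?_)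
                rw [le_div_iff₀ hei]; linarith
            _ = Real.exp (z / e i) := by
                rw [← Real.exp_add]; congr 1; rw [hδ]; field_simp; ring
  calc (e i : EReal) * ENNReal.log (∫⁻ y in A, ENNReal.ofReal (Real.exp (-(F i y / e i))) ∂ν)
      ≤ (e i : EReal) * ENNReal.log (ENNReal.ofReal (Real.exp (z / e i))) :=
        mul_le_mul_of_nonneg_left (ENNReal.log_le_log hle) (by exact_mod_cast hei.le)
    _ = (z : EReal) := by
        rw [ENNReal.log_ofReal, if_neg (Real.exp_pos _).not_ge, Real.log_exp, ← EReal.coe_mul]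
        congr 1; field_simp

/-- Lower large deviation bound on open sets for measures `exp (-F_ε / ε) ν` with `F_ε` uniformly
convergent. -/
lemma le_liminf_mul_log_setLIntegral_exp [TopologicalSpace Y] [BorelSpace Y]
    [ν.IsOpenPosMeasure] [IsLocallyFiniteMeasure ν]
    (he : Tendsto e l (𝓝[>] 0)) (hG : Continuous G) (hFG : TendstoUniformly F G l) {A : Set Y}
    (hA : IsOpen A) :
    -(⨅ y ∈ A, (G y : EReal)) ≤ liminf (fun i => (e i : EReal) *
      ENNReal.log (∫⁻ y in A, ENNReal.ofReal (Real.exp (-(F i y / e i))) ∂ν)) l := by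
  rw [EReal.neg_le]
  refine le_iInf₂ fun y hy => ?_
  rw [EReal.neg_le, ← EReal.coe_neg]
  refine EReal.ge_of_forall_gt_iff_ge.1 fun z hz => ?_
  have hz : z < -G y := by exact_mod_cast hz
  set δ := (-G y - z) / 3 with hδ
  have hδ0 : 0 < δ := by rw [hδ]; linarith
  obtain ⟨U, hyU, hUo, hUfin⟩ := ν.exists_isOpen_measure_lt_top y
  set B := A ∩ (U ∩ {z | G z < G y + δ})
  have hBo : IsOpen B := hA.inter (hUo.inter (isOpen_lt hG continuous_const))
  have hBfin : ν B < ⊤ :=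
    (measure_mono (Set.inter_subset_right.trans Set.inter_subset_left)).trans_lt hUfin
  have hyB : y ∈ B := ⟨hy, hyU, lt_add_of_pos_right (G y) hδ0⟩
  have hBpos : 0 < ν.real B :=
    ENNReal.toReal_pos (hBo.measure_pos ν ⟨y, hyB⟩).ne' hBfin.ne
  refine le_liminf_of_le (h := ?_)
  have he0 : Tendsto (fun i => -(e i * Real.log (ν.real B))) l (𝓝 0) := by
    simpa using ((he.mono_right nhdsWithin_le_nhds).mul_const (Real.log (ν.real B))).neg
  filter_upwards [eventually_forall_abs_sub_lt hFG hδ0, he.eventually self_mem_nhdsWithin,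
    he0.eventually (gt_mem_nhds hδ0)] with i hi hei hlog
  have hei : 0 < e i := hei
  have hle : ENNReal.ofReal (Real.exp (z / e i)) ≤
      ∫⁻ y in A, ENNReal.ofReal (Real.exp (-(F i y / e i))) ∂ν := by
    calc ENNReal.ofReal (Real.exp (z / e i))
        ≤ ENNReal.ofReal (Real.exp (-((G y + 2 * δ) / e i)) * ν.real B) := by
          refine ENNReal.ofReal_le_ofReal ?_
          rw [← Real.exp_log hBpos, ← Real.exp_add]
          refine Real.exp_le_exp.2 ?_
          rw [div_le_iff₀ hei, add_mul, neg_mul, div_mul_cancel₀ _ hei.ne']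
          linarith
      _ = ∫⁻ _ in B, ENNReal.ofReal (Real.exp (-((G y + 2 * δ) / e i))) ∂ν := by
          rw [setLIntegral_const, ENNReal.ofReal_mul (Real.exp_pos _).le,
            ofReal_measureReal hBfin.ne]
      _ ≤ ∫⁻ y in B, ENNReal.ofReal (Real.exp (-(F i y / e i))) ∂ν := by
          refine setLIntegral_mono' hBo.measurableSet fun x hx => ?_
          have h1 := (abs_lt.1 (hi x)).2
          have h2 : G x < G y + δ := hx.2.2
          refine ENNReal.ofReal_le_ofReal ?_
          gcongr
          linarith
      _ ≤ _ := lintegral_mono_set Set.inter_subset_left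
  calc (z : EReal) = (e i : EReal) * ENNReal.log (ENNReal.ofReal (Real.exp (z / e i))) := by
        rw [ENNReal.log_ofReal, if_neg (Real.exp_pos _).not_ge, Real.log_exp, ← EReal.coe_mul]
        congr 1; field_simp
    _ ≤ _ := mul_le_mul_of_nonneg_left (ENNReal.log_le_log hle) (by exact_mod_cast hei.le)

end Laplace

variable {N : ℕ}

/-! ### Semiconcave functions on the torus -/

lemma proj_add (v w : Vel N) : proj (v + w) = proj v + proj w := by
  ext i; simp [proj]

lemma proj_sub (v w : Vel N) : proj (v - w) = proj v - proj w := by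
  ext i; simp [proj]

@[fun_prop]
lemma continuous_proj : Continuous (proj : Vel N → Torus N) :=
  continuous_pi fun i => (AddCircle.continuous_mk' 1).comp (by fun_prop)

lemma exists_proj_eq (z : Torus N) : ∃ w : Vel N, proj w = z ∧ ‖w‖ ^ 2 ≤ N * ‖z‖ ^ 2 := by
  have hz : ∀ i, ∃ r : ℝ, (r : UnitAddCircle) = z i ∧ |r| = ‖z i‖ := by
    intro i
    obtain ⟨r, hr⟩ := QuotientAddGroup.mk_surjective (z i)
    refine ⟨r - round r, ?_, ?_⟩
    · rw [← hr]
      exact (QuotientAddGroup.eq_iff_sub_mem.2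
        (AddSubgroup.mem_zmultiples_iff.2 ⟨-round r, by simp⟩))
    · rw [← hr]; exact UnitAddCircle.norm_eq.symm
  choose r hr hrn using hz
  refine ⟨WithLp.toLp 2 r, funext hr, ?_⟩
  rw [EuclideanSpace.norm_sq_eq]
  calc ∑ i, ‖r i‖ ^ 2 ≤ ∑ _i : Fin N, ‖z‖ ^ 2 := by
        refine Finset.sum_le_sum fun i _ => ?_
        rw [Real.norm_eq_abs, hrn i]
        gcongr
        exact norm_le_pi_norm z i
    _ = _ := by simp

lemma torus_norm_le_one (z : Torus N) : ‖z‖ ≤ 1 := by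
  refine (pi_norm_le_iff_of_nonneg zero_le_one).2 fun i => ?_
  have := AddCircle.norm_le_half_period (p := (1 : ℝ)) (x := z i) one_ne_zero
  rw [abs_one] at this
  linarith

/-- Semiconcavity with a quadratic modulus, on second differences, with constant `K`. -/
def IsSemiconcave (K : ℝ) (φ : C(Torus N, ℝ)) : Prop :=
  ∀ (x : Torus N) (y : Vel N), φ (x + proj y) + φ (x - proj y) - 2 * φ x ≤ K * ‖y‖ ^ 2

/-- On the torus a semiconcave function has bounded oscillation: apply the second difference
inequality at a minimum point. -/
lemma IsSemiconcave.sub_le {K : ℝ} (hK : 0 ≤ K) {φ : C(Torus N, ℝ)} (hφ : IsSemiconcave K φ)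
    (x x' : Torus N) : φ x' - φ x ≤ K * N := by
  obtain ⟨x₀, -, hx₀⟩ := isCompact_univ.exists_isMinOn Set.univ_nonempty φ.continuous.continuousOn
  have hmin : ∀ z, φ x₀ ≤ φ z := fun z => hx₀ (Set.mem_univ z)
  obtain ⟨w, hw, hwn⟩ := exists_proj_eq (x' - x₀)
  have h := hφ x₀ w
  rw [hw, add_sub_cancel] at h
  have h1 : ‖x' - x₀‖ ^ 2 ≤ 1 := pow_le_one₀ (norm_nonneg _) (torus_norm_le_one _)
  have h2 : K * ‖w‖ ^ 2 ≤ K * N :=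
    mul_le_mul_of_nonneg_left (hwn.trans (mul_le_of_le_one_right (Nat.cast_nonneg N) h1)) hK
  linarith [hmin x, hmin (x₀ - (x' - x₀))]

/-- A lower bound on increments. Taking `n` large first and then `y` small makes it arbitrarily
close to zero, uniformly in `φ`. -/
lemma IsSemiconcave.neg_le_sub {K : ℝ} (hK : 0 ≤ K) {φ : C(Torus N, ℝ)} (hφ : IsSemiconcave K φ)
    (n : ℕ) (x : Torus N) (y : Vel N) :
    -(K * N / 2 ^ n + 2 ^ n * (K * ‖y‖ ^ 2)) ≤ φ (x + proj y) - φ x := by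
  -- Doubling the increment: the difference at `2 ^ n y` controls the difference at `y`.
  have hdouble : ∀ n : ℕ, φ (x + proj ((2 : ℝ) ^ n • y)) - φ x ≤
      2 ^ n * (φ (x + proj y) - φ x) + 4 ^ n * (K * ‖y‖ ^ 2) := by
    intro n
    induction n with
    | zero => simp; positivity
    | succ n ih =>
      have h := hφ (x + proj ((2 : ℝ) ^ n • y)) ((2 : ℝ) ^ n • y)
      rw [add_assoc, ← proj_add, add_sub_cancel_right, ← two_smul ℝ, smul_smul, norm_smul,
        mul_pow, Real.norm_of_nonneg (by positivity), ← pow_mul, mul_comm n 2, pow_mul] at h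
      have h4 : (2 : ℝ) ^ 2 = 4 := by norm_num
      have hp : 0 ≤ (4 : ℝ) ^ n * (K * ‖y‖ ^ 2) := by positivity
      rw [h4] at h
      rw [pow_succ' (2 : ℝ) n, pow_succ' (4 : ℝ) n]
      linarith
  have h1 := hdouble n
  have h2 := hφ.sub_le hK (x + proj ((2 : ℝ) ^ n • y)) x
  have h3 : (4 : ℝ) ^ n = 2 ^ n * 2 ^ n := by rw [← mul_pow]; norm_num
  have hp : (0 : ℝ) < 2 ^ n := by positivity
  have h4 : 2 ^ n * (K * N / 2 ^ n) = K * N := by field_simp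
  rw [h3] at h1
  refine le_of_mul_le_mul_left (a := (2 : ℝ) ^ n) ?_ hp
  linarith

/-- A common modulus of continuity for all semiconcave functions with a given constant. -/
lemma exists_modulus_of_isSemiconcave {K : ℝ} (hK : 0 ≤ K) {δ : ℝ} (hδ : 0 < δ) :
    ∃ η > 0, ∀ φ : C(Torus N, ℝ), IsSemiconcave K φ → ∀ x x', dist x x' < η →
      dist (φ x) (φ x') < δ := by
  obtain ⟨n, hn⟩ : ∃ n : ℕ, K * N / 2 ^ n < δ / 2 := by
    have : Tendsto (fun n : ℕ => K * N / (2 : ℝ) ^ n) atTop (𝓝 0) :=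
      tendsto_const_nhds.div_atTop (tendsto_pow_atTop_atTop_of_one_lt one_lt_two)
    exact (this.eventually (gt_mem_nhds (half_pos hδ))).exists
  obtain ⟨η, hη, hη'⟩ : ∃ η > 0, 2 ^ n * (K * (N * η ^ 2)) < δ / 2 := by
    have : Tendsto (fun η : ℝ => 2 ^ n * (K * (N * η ^ 2))) (𝓝[>] 0) (𝓝 0) := by
      have hc : Continuous fun η : ℝ => 2 ^ n * (K * (N * η ^ 2)) := by fun_prop
      simpa using (hc.tendsto 0).mono_left nhdsWithin_le_nhds
    obtain ⟨η, h1, h2⟩ :=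
      ((this.eventually (gt_mem_nhds (half_pos hδ))).and self_mem_nhdsWithin).exists
    exact ⟨η, h2, h1⟩
  have key : ∀ φ : C(Torus N, ℝ), IsSemiconcave K φ → ∀ x x', dist x x' < η →
      φ x - φ x' < δ := by
    intro φ hφ x x' hx
    obtain ⟨w, hw, hwn⟩ := exists_proj_eq (x' - x)
    have h := hφ.neg_le_sub hK n x w
    rw [hw, add_sub_cancel] at h
    have h1 : 2 ^ n * (K * ‖w‖ ^ 2) ≤ 2 ^ n * (K * (N * η ^ 2)) := by
      rw [dist_comm, dist_eq_norm] at hx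
      have : ‖x' - x‖ ^ 2 ≤ η ^ 2 := by gcongr
      gcongr
      exact hwn.trans (by gcongr)
    linarith
  refine ⟨η, hη, fun φ hφ x x' hx => ?_⟩
  rw [Real.dist_eq, abs_sub_lt_iff]
  exact ⟨key φ hφ x x' hx, key φ hφ x' x (by rwa [dist_comm])⟩

lemma isCompact_setOf_isSemiconcave {K : ℝ} (hK : 0 ≤ K) (B : ℝ) :
    IsCompact {φ : C(Torus N, ℝ) | IsSemiconcave K φ ∧ ∀ x, φ x ∈ Set.Icc (-B) B} := by
  set S := {φ : C(Torus N, ℝ) | IsSemiconcave K φ ∧ ∀ x, φ x ∈ Set.Icc (-B) B}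
  have hclosed : IsClosed S := by
    have hS : S = (⋂ (x : Torus N) (y : Vel N), {φ : C(Torus N, ℝ) |
        φ (x + proj y) + φ (x - proj y) - 2 * φ x ≤ K * ‖y‖ ^ 2}) ∩
        ⋂ x : Torus N, {φ : C(Torus N, ℝ) | φ x ∈ Set.Icc (-B) B} := by
      ext φ; simp [S, IsSemiconcave]
    rw [hS]
    have hev : ∀ x : Torus N, Continuous fun φ : C(Torus N, ℝ) => φ x := fun x =>
      continuous_eval_const x
    refine (isClosed_iInter fun x => isClosed_iInter fun y => isClosed_le ?_ continuous_const).inter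
      (isClosed_iInter fun x => isClosed_Icc.preimage (hev x))
    exact ((hev _).add (hev _)).sub ((hev _).const_mul 2)
  let Φ := ContinuousMap.isometryEquivBoundedOfCompact (Torus N) ℝ
  have hcomp : IsCompact (Φ.symm ⁻¹' S) := by
    refine BoundedContinuousFunction.arzela_ascoli₂ (Set.Icc (-B) B) isCompact_Icc _
      (hclosed.preimage Φ.symm.continuous) (fun f x hf => hf.2 x) ?_
    refine UniformEquicontinuous.equicontinuous (Metric.uniformEquicontinuous_iff.2 fun δ hδ => ?_)
    obtain ⟨η, hη, h⟩ := exists_modulus_of_isSemiconcave (N := N) hK hδ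
    exact ⟨η, hη, fun x x' hx f => h _ f.2.1 x x' hx⟩
  have himg : S = Φ.symm '' (Φ.symm ⁻¹' S) := (Set.image_preimage_eq _ Φ.symm.surjective).symm
  rw [himg]
  exact hcomp.image Φ.symm.continuous

section Fixed

/-! ### Integrability of Gibbs weights -/

instance isProbabilityMeasure_volume_torus :
    IsProbabilityMeasure (volume : Measure (Torus N)) := by
  have : IsProbabilityMeasure (volume : Measure UnitAddCircle) :=
    ⟨by rw [AddCircle.measure_univ, ENNReal.ofReal_one]⟩
  rw [volume_pi]; infer_instance

variable {L : Torus N → Vel N → ℝ}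

lemma IsLagrangian.exists_norm_sub_le (hL : IsLagrangian L) :
    ∃ c : ℝ, ∀ x v, ‖v‖ - c ≤ L x v := by
  obtain ⟨R, hR⟩ := hL.superlinear 1
  have hK : IsCompact ((Set.univ : Set (Torus N)) ×ˢ Metric.closedBall (0 : Vel N) R) :=
    isCompact_univ.prod (isCompact_closedBall 0 R)
  obtain ⟨m, hm⟩ := hK.bddBelow_image hL.continuous.continuousOn
  refine ⟨|R| + |m|, fun x v => ?_⟩
  rcases lt_or_ge R ‖v‖ with hv | hv
  · have h1 := hR x v hv
    have hpos : 0 < ‖v‖ := by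
      rcases (norm_nonneg v).eq_or_lt with h0 | h0
      · rw [← h0, div_zero] at h1; linarith
      · exact h0
    rw [lt_div_iff₀ hpos] at h1
    linarith [abs_nonneg R, abs_nonneg m]
  · have h1 : m ≤ L x v := hm ⟨(x, v), ⟨trivial, by simpa using hv⟩, rfl⟩
    linarith [le_abs_self R, neg_abs_le m]

/-- Coercivity of linear rate suffices; `integrable_exp_neg_prod` is the same on `𝕋^N × ℝ^N`. -/
lemma integrable_exp_neg_of_norm_le {g : Vel N → ℝ} (hg : Continuous g) {a C : ℝ} (ha : 0 < a)
    (hle : ∀ v, a * ‖v‖ - C ≤ g v) : Integrable (fun v => Real.exp (-g v)) := by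
  refine ((integrable_exp_neg_mul_norm volume ha).const_mul (Real.exp C)).mono' (by fun_prop)
    (.of_forall fun v => ?_)
  rw [Real.norm_of_nonneg (Real.exp_pos _).le, ← Real.exp_add]
  exact Real.exp_le_exp.2 (by linarith [hle v])

lemma integrable_exp_neg_prod {g : Torus N × Vel N → ℝ} (hg : Continuous g) {a C : ℝ}
    (ha : 0 < a) (hle : ∀ p, a * ‖p.2‖ - C ≤ g p) : Integrable (fun p => Real.exp (-g p)) := by
  have h := (integrable_const (μ := (volume : Measure (Torus N))) (Real.exp C)).mul_prod
    (integrable_exp_neg_mul_norm (volume : Measure (Vel N)) ha)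
  refine h.mono' (Continuous.aestronglyMeasurable (by fun_prop)) (.of_forall fun p => ?_)
  rw [Real.norm_of_nonneg (Real.exp_pos _).le, ← Real.exp_add]
  exact Real.exp_le_exp.2 (by linarith [hle p])

lemma abs_apply_le_norm (φ : C(Torus N, ℝ)) (x : Torus N) : |φ x| ≤ ‖φ‖ :=
  φ.norm_coe_le_norm x

lemma IsLagrangian.continuous_comp (hL : IsLagrangian L) {Y : Type*} [TopologicalSpace Y]
    {p : Y → Torus N} {q : Y → Vel N} (hp : Continuous p) (hq : Continuous q) :
    Continuous fun y => L (p y) (q y) :=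
  hL.continuous.comp (hp.prodMk hq)

/-- Integrability of the weights in `𝒢` and `𝒢̄`, which correspond to `(p v, q v) = (x, x + hv)` and
to `p v = q v = x - hv`. -/
lemma IsLagrangian.integrable_exp_neg_div (hL : IsLagrangian L) {h t : ℝ} (hh : 0 < h)
    (ht : 0 < t) (φ : C(Torus N, ℝ)) {p q : Vel N → Torus N} (hp : Continuous p)
    (hq : Continuous q) :
    Integrable (fun v => Real.exp (-((h * L (p v) v + φ (q v)) / t))) := by
  obtain ⟨c, hc⟩ := hL.exists_norm_sub_le
  have hLc := hL.continuous_comp hp continuous_id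
  simp only [id] at hLc
  refine integrable_exp_neg_of_norm_le (a := h / t) (C := (h * c + ‖φ‖) / t)
    (((hLc.const_mul h).add (φ.continuous.comp hq)).div_const t) (by positivity) fun v => ?_
  have h1 := mul_le_mul_of_nonneg_left (hc (p v) v) hh.le
  have h2 := (abs_le.1 (abs_apply_le_norm φ (q v))).1
  rw [div_mul_eq_mul_div, ← sub_div]
  gcongr
  linarith

/-! ### Uniform semiconcavity of the fixed points -/

variable {ε h : ℝ} {φ φbar : C(Torus N, ℝ)} {l : ℝ}

lemma isSemiconcave_of_opG_eq (hL : IsLagrangian L) (hh : 0 < h) (hε : 0 < ε) {C Γ : ℝ}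
    (hC : ∀ (x : Torus N) (v y z : Vel N), L (x + proj y) (v - z) + L (x - proj y) (v + z) -
      2 * L x v ≤ C * ‖y‖ ^ 2 + Γ * ‖z‖ ^ 2)
    (hφ : ∀ x, opG L ε h φ x = φ x + l) : IsSemiconcave (h * C + Γ / h) φ := by
  intro x y
  have he : 0 < ε * h := by positivity
  set z : Vel N := h⁻¹ • y with hz
  have hhz : h • z = y := by rw [hz, smul_smul, mul_inv_cancel₀ hh.ne', one_smul]
  have hyn : h * (Γ * ‖z‖ ^ 2) = Γ / h * ‖y‖ ^ 2 := by
    rw [hz, norm_smul, mul_pow, norm_inv, Real.norm_of_nonneg hh.le]; field_simp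
  -- The velocity is shifted by `∓ y / h`, so that the endpoint `x + hv` does not move with `y`.
  have hplus : opG L ε h φ (x + proj y) = -(ε * h) * Real.log (∫ v : Vel N, Real.exp
      (-((h * L (x + proj y) (v - z) + φ (x + proj (h • v))) / (ε * h)))) := by
    rw [opG, ← integral_sub_right_eq_self _ z]
    simp only [smul_sub, hhz, proj_sub, add_add_sub_cancel]
  have hminus : opG L ε h φ (x - proj y) = -(ε * h) * Real.log (∫ v : Vel N, Real.exp
      (-((h * L (x - proj y) (v + z) + φ (x + proj (h • v))) / (ε * h)))) := by
    rw [opG, ← integral_add_right_eq_self _ z]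
    have (v : Vel N) : x - proj y + (proj (h • v) + proj y) = x + proj (h • v) := by abel
    simp only [smul_add, hhz, proj_add, this]
  have i0 := hL.integrable_exp_neg_div hh he φ (p := fun _ => x)
    (q := fun v => x + proj (h • v)) (by fun_prop) (by fun_prop)
  have i1 := (hL.integrable_exp_neg_div hh he φ (p := fun _ => x + proj y)
    (q := fun v => x + proj y + proj (h • v)) (by fun_prop) (by fun_prop)).comp_sub_right z
  have i2 := (hL.integrable_exp_neg_div hh he φ (p := fun _ => x - proj y)
    (q := fun v => x - proj y + proj (h • v)) (by fun_prop) (by fun_prop)).comp_add_right z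
  have e1 (v : Vel N) : x + proj y + proj (h • (v - z)) = x + proj (h • v) := by
    rw [smul_sub, hhz, proj_sub]; abel
  have e2 (v : Vel N) : x - proj y + proj (h • (v + z)) = x + proj (h • v) := by
    rw [smul_add, hhz, proj_add]; abel
  simp only [e1] at i1
  simp only [e2] at i2
  have hmid := two_mul_log_integral_exp_le (K := (h * C + Γ / h) * ‖y‖ ^ 2 / (ε * h)) i1 i2 i0
    fun v => by
      have := mul_le_mul_of_nonneg_left (hC x v y z) hh.le
      rw [← neg_div, ← neg_div, ← neg_div, ← mul_div_assoc, ← add_div, ← add_div]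
      gcongr
      linarith
  have h0 := hφ x
  have h1 := hφ (x + proj y)
  have h2 := hφ (x - proj y)
  rw [hplus] at h1
  rw [hminus] at h2
  rw [opG] at h0
  have hm := mul_le_mul_of_nonneg_left hmid he.le
  rw [mul_add, mul_div_cancel₀ _ he.ne'] at hm
  linarith

lemma isSemiconcave_of_opGbar_eq (hL : IsLagrangian L) (hh : 0 < h) (hε : 0 < ε) {C Γ : ℝ}
    (hC0 : 0 ≤ C)
    (hC : ∀ (x : Torus N) (v y z : Vel N), L (x + proj y) (v - z) + L (x - proj y) (v + z) -
      2 * L x v ≤ C * ‖y‖ ^ 2 + Γ * ‖z‖ ^ 2)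
    (hφ : ∀ x, opGbar L ε h φbar x = φbar x + l) : IsSemiconcave (h * C + Γ / h) φbar := by
  intro x y
  have he : 0 < ε * h := by positivity
  set z : Vel N := h⁻¹ • y with hz
  have hhz : h • z = y := by rw [hz, smul_smul, mul_inv_cancel₀ hh.ne', one_smul]
  have hyn : h * (Γ * ‖z‖ ^ 2) = Γ / h * ‖y‖ ^ 2 := by
    rw [hz, norm_smul, mul_pow, norm_inv, Real.norm_of_nonneg hh.le]; field_simp
  have e1 (v : Vel N) : x + proj y - proj (h • (v + z)) = x - proj (h • v) := by
    rw [smul_add, hhz, proj_add]; abel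
  have e2 (v : Vel N) : x - proj y - proj (h • (v - z)) = x - proj (h • v) := by
    rw [smul_sub, hhz, proj_sub]; abel
  -- The velocity is shifted by `± y / h`, so that the starting point `x - hv` does not move with
  -- `y`.
  have hplus : opGbar L ε h φbar (x + proj y) = -(ε * h) * Real.log (∫ v : Vel N, Real.exp
      (-((h * L (x - proj (h • v)) (v + z) + φbar (x - proj (h • v))) / (ε * h)))) := by
    rw [opGbar, ← integral_add_right_eq_self _ z]
    simp only [e1]
  have hminus : opGbar L ε h φbar (x - proj y) = -(ε * h) * Real.log (∫ v : Vel N, Real.exp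
      (-((h * L (x - proj (h • v)) (v - z) + φbar (x - proj (h • v))) / (ε * h)))) := by
    rw [opGbar, ← integral_sub_right_eq_self _ z]
    simp only [e2]
  have i0 := hL.integrable_exp_neg_div hh he φbar (p := fun v => x - proj (h • v))
    (q := fun v => x - proj (h • v)) (by fun_prop) (by fun_prop)
  have i1 := (hL.integrable_exp_neg_div hh he φbar (p := fun v => x + proj y - proj (h • v))
    (q := fun v => x + proj y - proj (h • v)) (by fun_prop) (by fun_prop)).comp_add_right z
  have i2 := (hL.integrable_exp_neg_div hh he φbar (p := fun v => x - proj y - proj (h • v))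
    (q := fun v => x - proj y - proj (h • v)) (by fun_prop) (by fun_prop)).comp_sub_right z
  simp only [e1] at i1
  simp only [e2] at i2
  have hmid := two_mul_log_integral_exp_le (K := (h * C + Γ / h) * ‖y‖ ^ 2 / (ε * h)) i1 i2 i0
    fun v => by
      have := mul_le_mul_of_nonneg_left (hC (x - proj (h • v)) v 0 z) hh.le
      have hp0 : proj (0 : Vel N) = 0 := by ext i; simp [proj]
      rw [hp0, add_zero, sub_zero, norm_zero] at this
      have hCy : 0 ≤ h * C * ‖y‖ ^ 2 := by positivity
      rw [← neg_div, ← neg_div, ← neg_div, ← mul_div_assoc, ← add_div, ← add_div]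
      gcongr
      linarith
  have h0 := hφ x
  have h1 := hφ (x + proj y)
  have h2 := hφ (x - proj y)
  rw [hplus] at h1
  rw [hminus] at h2
  rw [opGbar] at h0
  have hm := mul_le_mul_of_nonneg_left hmid he.le
  rw [mul_add, mul_div_cancel₀ _ he.ne'] at hm
  linarith

/-- All normalized fixed pairs lie in a fixed compact set, whatever the value of `ε`. -/
lemma exists_isCompact_of_isNormalizedFixedPair (hL : IsLagrangian L) (hh : 0 < h) :
    ∃ S : Set C(Torus N, ℝ), IsCompact S ∧ ∀ (ε : ℝ) (φ φbar : C(Torus N, ℝ)) (l : ℝ), 0 < ε →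
      IsNormalizedFixedPair L ε h φ φbar l → φ ∈ S ∧ φbar ∈ S := by
  obtain ⟨C, Γ, hC0, hΓ0, hC⟩ := hL.semiconcave
  have hK : 0 ≤ h * C + Γ / h := by positivity
  set K := h * C + Γ / h
  refine ⟨_, isCompact_setOf_isSemiconcave (N := N) hK (2 * (K * N)), fun ε φ φbar l hε hp => ?_⟩
  have he : 0 < ε * h := by positivity
  have s1 : IsSemiconcave K φ := isSemiconcave_of_opG_eq hL hh hε hC hp.forward
  have s2 : IsSemiconcave K φbar := isSemiconcave_of_opGbar_eq hL hh hε hC0.le hC hp.backward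
  have hKN : 0 ≤ K * N := by positivity
  have b1 : ∀ x, |φ x| ≤ K * N := fun x => by
    have h1 := s1.sub_le hK 0 x
    have h2 := s1.sub_le hK x 0
    rw [hp.zero] at h1 h2
    exact abs_le.2 ⟨by linarith, by linarith⟩
  have hint : Integrable fun x : Torus N => Real.exp (-((φbar x + φ x) / (ε * h))) :=
    integrableOn_univ.1
      (Continuous.continuousOn (by fun_prop) |>.integrableOn_compact isCompact_univ)
  -- The normalization forces `φ̄ + φ` to take both nonnegative and nonpositive values.
  obtain ⟨x₁, hx₁⟩ := exists_le_integral hint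
  obtain ⟨x₂, hx₂⟩ := exists_integral_le hint
  rw [hp.normalized, Real.exp_le_one_iff, neg_nonpos, le_div_iff₀ he, zero_mul] at hx₁
  rw [hp.normalized, Real.one_le_exp_iff, neg_nonneg, div_le_iff₀ he, zero_mul] at hx₂
  refine ⟨⟨s1, fun x => ?_⟩, ⟨s2, fun x => ?_⟩⟩
  · have := abs_le.1 (b1 x)
    exact ⟨by linarith, by linarith⟩
  · have h1 := abs_le.1 (b1 x₁)
    have h2 := abs_le.1 (b1 x₂)
    have h3 := s2.sub_le hK x x₁
    have h4 := s2.sub_le hK x₂ x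
    exact ⟨by linarith, by linarith⟩

end Fixed

section Measure

/-! ### The entropy measure is a holonomic probability measure -/

variable {L : Torus N → Vel N → ℝ} {ε h : ℝ} {φ φbar : C(Torus N, ℝ)} {l : ℝ}

lemma density_eq_exp (L : Torus N → Vel N → ℝ) (ε h : ℝ) (φ φbar : C(Torus N, ℝ)) (l : ℝ)
    (p : Torus N × Vel N) : density L ε h φ φbar l p = Real.exp
      (-((h * L p.1 p.2 + φ (p.1 + proj (h • p.2)) + φbar p.1 - l) / (ε * h))) := by
  rw [density, ← Real.exp_add]
  congr 1
  ring

lemma density_pos (p : Torus N × Vel N) : 0 < density L ε h φ φbar l p := by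
  rw [density_eq_exp]; exact Real.exp_pos _

lemma IsLagrangian.continuous_density (hL : IsLagrangian L) :
    Continuous (density L ε h φ φbar l) := by
  have hLc := hL.continuous
  unfold density
  fun_prop

/-- The density of the entropy measure has exponential moments of `L` of every order below
`1 / ε`. -/
lemma IsLagrangian.integrable_exp_mul_density (hL : IsLagrangian L) (hh : 0 < h) (hε : 0 < ε)
    {s : ℝ} (hs : s < 1 / ε) :
    Integrable fun p : Torus N × Vel N =>
      Real.exp (s * L p.1 p.2) * density L ε h φ φbar l p := by
  obtain ⟨c, hc⟩ := hL.exists_norm_sub_le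
  have hLc := hL.continuous
  have heq : (fun p : Torus N × Vel N => Real.exp (s * L p.1 p.2) * density L ε h φ φbar l p) =
      fun p => Real.exp (-((1 / ε - s) * L p.1 p.2 +
        (φ (p.1 + proj (h • p.2)) + φbar p.1 - l) / (ε * h))) := by
    funext p
    rw [density_eq_exp, ← Real.exp_add]
    congr 1
    field_simp
    ring
  rw [heq]
  refine integrable_exp_neg_prod (a := 1 / ε - s)
    (C := (1 / ε - s) * c + (‖φ‖ + ‖φbar‖ + |l|) / (ε * h)) (by fun_prop) (by linarith)
    fun p => ?_
  have h1 := mul_le_mul_of_nonneg_left (hc p.1 p.2) (by linarith : 0 ≤ 1 / ε - s)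
  have h2 : -((‖φ‖ + ‖φbar‖ + |l|) / (ε * h)) ≤
      (φ (p.1 + proj (h • p.2)) + φbar p.1 - l) / (ε * h) := by
    rw [← neg_div]
    have := (abs_le.1 (abs_apply_le_norm φ (p.1 + proj (h • p.2)))).1
    have := (abs_le.1 (abs_apply_le_norm φbar p.1)).1
    have := le_abs_self l
    gcongr
    linarith
  linarith

lemma IsLagrangian.integrable_density (hL : IsLagrangian L) (hh : 0 < h) (hε : 0 < ε) :
    Integrable (density L ε h φ φbar l) := by
  simpa using hL.integrable_exp_mul_density (φ := φ) (φbar := φbar) (l := l) hh hε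
    (s := 0) (by positivity)

lemma IsLagrangian.integrable_mul_density (hL : IsLagrangian L) (hh : 0 < h) (hε : 0 < ε) :
    Integrable fun p : Torus N × Vel N => L p.1 p.2 * density L ε h φ φbar l p := by
  have hLc := hL.continuous
  have hDc := hL.continuous_density (ε := ε) (h := h) (φ := φ) (φbar := φbar) (l := l)
  -- `|L|` is dominated by `(exp (s L) + exp (-s L)) / s`, and `s` is within the range of the
  -- exponential moments.
  set s := 1 / (2 * ε) with hs
  have hs0 : 0 < s := by positivity
  have hs1 : s < 1 / ε := by rw [hs]; gcongr; linarith
  have i1 := hL.integrable_exp_mul_density (φ := φ) (φbar := φbar) (l := l) hh hε hs1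
  have i2 := hL.integrable_exp_mul_density (φ := φ) (φbar := φbar) (l := l) hh hε
    (s := -s) (by linarith)
  refine ((i1.add i2).const_mul s⁻¹).mono' (hLc.mul hDc).aestronglyMeasurable
    (.of_forall fun p => ?_)
  have hD := (density_pos (L := L) (ε := ε) (h := h) (φ := φ) (φbar := φbar) (l := l) p).le
  have habs : s * |L p.1 p.2| ≤ Real.exp (s * L p.1 p.2) + Real.exp (-s * L p.1 p.2) := by
    have h1 := Real.add_one_le_exp (s * |L p.1 p.2|)
    rcases abs_cases (L p.1 p.2) with ⟨h2, -⟩ | ⟨h2, -⟩ <;> rw [h2] at h1 ⊢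
    · linarith [Real.exp_pos (-s * L p.1 p.2)]
    · rw [mul_neg, ← neg_mul] at h1 ⊢
      linarith [Real.exp_pos (s * L p.1 p.2)]
  rw [Real.norm_eq_abs, abs_mul, abs_of_nonneg hD, Pi.add_apply, ← add_mul, ← mul_assoc]
  refine mul_le_mul_of_nonneg_right ?_ hD
  rw [inv_mul_eq_div, le_div_iff₀ hs0]
  linarith

lemma IsLagrangian.integrable_bounded_mul_density (hL : IsLagrangian L) (hh : 0 < h)
    (hε : 0 < ε) (ψ : C(Torus N, ℝ)) {q : Torus N × Vel N → Torus N} (hq : Continuous q) :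
    Integrable fun p => ψ (q p) * density L ε h φ φbar l p :=
  (hL.integrable_density hh hε).bdd_mul (ψ.continuous.comp hq).aestronglyMeasurable
    (.of_forall fun p => ψ.norm_coe_le_norm (q p))

/-- The forward equation: the first marginal of the entropy measure has density `θ`. -/
lemma integral_density_fiber (hL : IsLagrangian L) (hh : 0 < h) (hε : 0 < ε)
    (hp : IsNormalizedFixedPair L ε h φ φbar l) (x : Torus N) :
    ∫ v : Vel N, density L ε h φ φbar l (x, v) =
      Real.exp (-((φbar x + φ x) / (ε * h))) := by
  have he : 0 < ε * h := by positivity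
  have hf := hp.forward x
  have hi := hL.integrable_exp_neg_div hh he φ (p := fun _ => x)
    (q := fun v => x + proj (h • v)) (by fun_prop) (by fun_prop)
  have hpos := integral_exp_pos hi
  rw [opG] at hf
  have hD (v : Vel N) : density L ε h φ φbar l (x, v) =
      Real.exp (-((φbar x - l) / (ε * h))) *
        Real.exp (-((h * L x v + φ (x + proj (h • v))) / (ε * h))) := by
    rw [density_eq_exp, ← Real.exp_add]
    congr 1
    ring
  simp only [hD]
  rw [integral_const_mul, ← Real.exp_log hpos, ← Real.exp_add]
  congr 1
  field_simp
  linarith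

/-- The backward equation: the endpoint `x + hv` has the same density `θ`. -/
lemma integral_density_shift (hL : IsLagrangian L) (hh : 0 < h) (hε : 0 < ε)
    (hp : IsNormalizedFixedPair L ε h φ φbar l) (y : Torus N) :
    ∫ v : Vel N, density L ε h φ φbar l (y - proj (h • v), v) =
      Real.exp (-((φbar y + φ y) / (ε * h))) := by
  have he : 0 < ε * h := by positivity
  have hf := hp.backward y
  have hi := hL.integrable_exp_neg_div hh he φbar (p := fun v => y - proj (h • v))
    (q := fun v => y - proj (h • v)) (by fun_prop) (by fun_prop)
  have hpos := integral_exp_pos hi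
  rw [opGbar] at hf
  have hD (v : Vel N) : density L ε h φ φbar l (y - proj (h • v), v) =
      Real.exp (-((φ y - l) / (ε * h))) * Real.exp (-((h * L (y - proj (h • v)) v +
        φbar (y - proj (h • v))) / (ε * h))) := by
    rw [density_eq_exp, ← Real.exp_add]
    simp only [sub_add_cancel]
    congr 1
    ring
  simp only [hD]
  rw [integral_const_mul, ← Real.exp_log hpos, ← Real.exp_add]
  congr 1
  field_simp
  linarith

lemma measurePreserving_shift (h : ℝ) :
    MeasurePreserving (fun p : Torus N × Vel N => (p.1 - proj (h • p.2), p.2)) := by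
  have h1 : MeasurePreserving (fun q : Vel N × Torus N => (q.1, q.2 - proj (h • q.1))) :=
    (MeasurePreserving.id (volume : Measure (Vel N))).skew_product
      (g := fun v x => x - proj (h • v)) (μc := (volume : Measure (Torus N)))
      (μd := (volume : Measure (Torus N)))
      (Continuous.measurable (by fun_prop))
      (.of_forall fun v => (measurePreserving_sub_right volume (proj (h • v))).map_eq)
  exact (Measure.measurePreserving_swap.comp h1).comp Measure.measurePreserving_swap

lemma integral_mul_density_left (hL : IsLagrangian L) (hh : 0 < h) (hε : 0 < ε)
    (hp : IsNormalizedFixedPair L ε h φ φbar l) (ψ : C(Torus N, ℝ)) :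
    ∫ p : Torus N × Vel N, ψ p.1 * density L ε h φ φbar l p =
      ∫ x, ψ x * Real.exp (-((φbar x + φ x) / (ε * h))) := by
  rw [Measure.volume_eq_prod,
    integral_prod _ (hL.integrable_bounded_mul_density hh hε ψ continuous_fst)]
  simp only [integral_const_mul, integral_density_fiber hL hh hε hp]

/-- The law of the endpoint `x + hv`, by the change of variables `y = x + hv`. -/
lemma integral_mul_density_right (hL : IsLagrangian L) (hh : 0 < h) (hε : 0 < ε)
    (hp : IsNormalizedFixedPair L ε h φ φbar l) (ψ : C(Torus N, ℝ)) :
    ∫ p : Torus N × Vel N, ψ (p.1 + proj (h • p.2)) * density L ε h φ φbar l p =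
      ∫ x, ψ x * Real.exp (-((φbar x + φ x) / (ε * h))) := by
  have hT := measurePreserving_shift (N := N) h
  have hDc := hL.continuous_density (ε := ε) (h := h) (φ := φ) (φbar := φbar) (l := l)
  have hg : Continuous fun p : Torus N × Vel N =>
      ψ (p.1 + proj (h • p.2)) * density L ε h φ φbar l p := by fun_prop
  have hi := hL.integrable_bounded_mul_density (φ := φ) (φbar := φbar) (l := l) hh hε ψ
    (q := fun p => p.1 + proj (h • p.2)) (by fun_prop)
  have hi' : Integrable fun p : Torus N × Vel N =>
      ψ (p.1 - proj (h • p.2) + proj (h • p.2)) *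
        density L ε h φ φbar l (p.1 - proj (h • p.2), p.2) := hT.integrable_comp_of_integrable hi
  have hmap := integral_map (μ := volume) hT.measurable.aemeasurable hg.aestronglyMeasurable
  rw [hT.map_eq] at hmap
  simp only [sub_add_cancel] at hi' hmap
  rw [hmap, Measure.volume_eq_prod, integral_prod _ hi']
  simp only [integral_const_mul, integral_density_shift hL hh hε hp]

lemma IsLagrangian.integral_entropyMeasure (hL : IsLagrangian L) (g : Torus N × Vel N → ℝ) :
    ∫ p, g p ∂(entropyMeasure L ε h φ φbar l) = ∫ p, g p * density L ε h φ φbar l p := by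
  have hm : Measurable fun p => ENNReal.ofReal (density L ε h φ φbar l p) :=
    hL.continuous_density.measurable.ennreal_ofReal
  rw [entropyMeasure, integral_withDensity_eq_integral_toReal_smul hm (by simp)]
  simp only [ENNReal.toReal_ofReal (density_pos _).le, smul_eq_mul, mul_comm]

lemma IsLagrangian.integrable_entropyMeasure_iff (hL : IsLagrangian L)
    {g : Torus N × Vel N → ℝ} : Integrable g (entropyMeasure L ε h φ φbar l) ↔
      Integrable fun p => g p * density L ε h φ φbar l p := by
  have hm : Measurable fun p => ENNReal.ofReal (density L ε h φ φbar l p) :=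
    hL.continuous_density.measurable.ennreal_ofReal
  rw [entropyMeasure, integrable_withDensity_iff_integrable_smul' hm (by simp)]
  simp only [ENNReal.toReal_ofReal (density_pos _).le, smul_eq_mul, mul_comm]

lemma integral_density (hL : IsLagrangian L) (hh : 0 < h) (hε : 0 < ε)
    (hp : IsNormalizedFixedPair L ε h φ φbar l) :
    ∫ p : Torus N × Vel N, density L ε h φ φbar l p = 1 := by
  simpa [hp.normalized] using integral_mul_density_left hL hh hε hp 1

lemma isHolonomic_entropyMeasure (hL : IsLagrangian L) (hh : 0 < h) (hε : 0 < ε)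
    (hp : IsNormalizedFixedPair L ε h φ φbar l) :
    IsHolonomic h (entropyMeasure L ε h φ φbar l) := by
  refine ⟨⟨?_⟩, fun ψ => ?_⟩
  · rw [entropyMeasure, withDensity_apply _ MeasurableSet.univ, setLIntegral_univ,
      ← ofReal_integral_eq_lintegral_ofReal (hL.integrable_density hh hε)
        (.of_forall fun p => (density_pos p).le), integral_density hL hh hε hp, ENNReal.ofReal_one]
  · rw [hL.integral_entropyMeasure]
    simp only [sub_mul]
    rw [integral_sub (hL.integrable_bounded_mul_density hh hε ψ (by fun_prop))
      (hL.integrable_bounded_mul_density hh hε ψ (by fun_prop)),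
      integral_mul_density_right hL hh hε hp, integral_mul_density_left hL hh hε hp, sub_self]

/-! ### The penalized action -/

/-- The terms `φ (x + hv) - φ x` integrate to zero against a holonomic measure, so that the
logarithm of the transition density has the mean of `-(h L - l) / (ε h)`. -/
lemma integral_action_mul_density (hL : IsLagrangian L) (hh : 0 < h) (hε : 0 < ε)
    (hp : IsNormalizedFixedPair L ε h φ φbar l) :
    Integrable (fun p : Torus N × Vel N => ((h * L p.1 p.2 + φ (p.1 + proj (h • p.2)) - φ p.1 - l)
      / (ε * h)) * density L ε h φ φbar l p) ∧
    ∫ p : Torus N × Vel N, ((h * L p.1 p.2 + φ (p.1 + proj (h • p.2)) - φ p.1 - l)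
      / (ε * h)) * density L ε h φ φbar l p =
      (∫ p : Torus N × Vel N, L p.1 p.2 * density L ε h φ φbar l p) / ε - l / (ε * h) := by
  have i1 := (hL.integrable_mul_density (φ := φ) (φbar := φbar) (l := l) hh hε).const_mul (1 / ε)
  have i2 := (hL.integrable_bounded_mul_density (φ := φ) (φbar := φbar) (l := l) hh hε φ
    (q := fun p => p.1 + proj (h • p.2)) (by fun_prop)).const_mul (1 / (ε * h))
  have i3 := (hL.integrable_bounded_mul_density (φ := φ) (φbar := φbar) (l := l) hh hε φ
    (q := fun p => p.1) (by fun_prop)).const_mul (1 / (ε * h))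
  have i4 := (hL.integrable_density (φ := φ) (φbar := φbar) (l := l) hh hε).const_mul (l / (ε * h))
  have heq : (fun p : Torus N × Vel N => ((h * L p.1 p.2 + φ (p.1 + proj (h • p.2)) - φ p.1 - l)
      / (ε * h)) * density L ε h φ φbar l p) = fun p =>
      1 / ε * (L p.1 p.2 * density L ε h φ φbar l p) +
      1 / (ε * h) * (φ (p.1 + proj (h • p.2)) * density L ε h φ φbar l p) -
      1 / (ε * h) * (φ p.1 * density L ε h φ φbar l p) -
      l / (ε * h) * density L ε h φ φbar l p := by
    funext p
    field_simp
  rw [heq]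
  refine ⟨((i1.add i2).sub i3).sub i4, ?_⟩
  have e1 := integral_sub ((i1.add i2).sub i3) i4
  have e2 := integral_sub (i1.add i2) i3
  simp only [Pi.add_apply, Pi.sub_apply] at e1 e2
  rw [e1, e2, integral_add i1 i2]
  simp only [integral_const_mul]
  rw [integral_mul_density_left hL hh hε hp, integral_mul_density_right hL hh hε hp,
    integral_density hL hh hε hp]
  ring

lemma penalizedAction_eq (hL : IsLagrangian L) (hh : 0 < h) (hε : 0 < ε)
    (hp : IsNormalizedFixedPair L ε h φ φbar l) :
    penalizedAction L ε h φ φbar l = l / h := by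
  have hlog (p : Torus N × Vel N) : density L ε h φ φbar l p * Real.log
      (density L ε h φ φbar l p / ∫ w : Vel N, density L ε h φ φbar l (p.1, w)) =
      -(((h * L p.1 p.2 + φ (p.1 + proj (h • p.2)) - φ p.1 - l) / (ε * h)) *
        density L ε h φ φbar l p) := by
    rw [integral_density_fiber hL hh hε hp]
    nth_rw 2 [density]
    rw [mul_div_cancel_left₀ _ (Real.exp_pos _).ne', Real.log_exp]
    ring
  rw [penalizedAction, entropy]
  simp only [hlog]
  rw [integral_neg, (integral_action_mul_density hL hh hε hp).2, hL.integral_entropyMeasure]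
  field_simp
  ring

lemma density_eq_exp_penalizedRate (hL : IsLagrangian L) (hh : 0 < h) (hε : 0 < ε)
    (hp : IsNormalizedFixedPair L ε h φ φbar l) (p : Torus N × Vel N) :
    density L ε h φ φbar l p = Real.exp (-(penalizedRate L ε h φ φbar l p / ε)) := by
  rw [density_eq_exp, penalizedRate, penalizedAction_eq hL hh hε hp]
  congr 1
  field_simp
  ring

lemma entropyMeasure_apply (hL : IsLagrangian L) (hh : 0 < h) (hε : 0 < ε)
    (hp : IsNormalizedFixedPair L ε h φ φbar l) (A : Set (Torus N × Vel N)) :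
    entropyMeasure L ε h φ φbar l A =
      ∫⁻ p in A, ENNReal.ofReal (Real.exp (-(penalizedRate L ε h φ φbar l p / ε))) := by
  rw [entropyMeasure, withDensity_apply' _ A]
  simp only [density_eq_exp_penalizedRate hL hh hε hp]

/-! ### Convergence of the eigenvalue to the critical value -/

lemma bddBelow_actions (hL : IsLagrangian L) (h : ℝ) :
    BddBelow {a : ℝ | ∃ μ : Measure (Torus N × Vel N), IsHolonomic h μ ∧
      Integrable (fun p => L p.1 p.2) μ ∧ a = ∫ p, L p.1 p.2 ∂μ} := by
  obtain ⟨c, hc⟩ := hL.exists_norm_sub_le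
  refine ⟨-c, ?_⟩
  rintro _ ⟨μ, hμ, hi, rfl⟩
  have := hμ.isProbabilityMeasure
  have h1 := integral_mono (integrable_const (μ := μ) (-c)) hi
    fun p => by linarith [hc p.1 p.2, norm_nonneg p.2]
  simpa using h1

lemma integral_mem_actions (hL : IsLagrangian L) (hh : 0 < h) (hε : 0 < ε)
    (hp : IsNormalizedFixedPair L ε h φ φbar l) :
    ∫ p : Torus N × Vel N, L p.1 p.2 * density L ε h φ φbar l p ∈
      {a : ℝ | ∃ μ : Measure (Torus N × Vel N), IsHolonomic h μ ∧
        Integrable (fun p => L p.1 p.2) μ ∧ a = ∫ p, L p.1 p.2 ∂μ} :=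
  ⟨_, isHolonomic_entropyMeasure hL hh hε hp,
    hL.integrable_entropyMeasure_iff.2 (hL.integrable_mul_density hh hε),
    (hL.integral_entropyMeasure _).symm⟩

/-- Lower bound of the eigenvalue. The entropy measure is a competitor for `H̄_h`, and Gibbs'
inequality against the reference density `exp (-L - c)` bounds its entropy from below. -/
lemma exists_forall_criticalValue_le (hL : IsLagrangian L) (hh : 0 < h) :
    ∃ c : ℝ, ∀ (ε : ℝ) (φ φbar : C(Torus N, ℝ)) (l : ℝ), 0 < ε → ε ≤ 1 →
      IsNormalizedFixedPair L ε h φ φbar l →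
      (1 - ε) * criticalValue L h ≤ l / h + ε * c := by
  obtain ⟨c₀, hc₀⟩ := hL.exists_norm_sub_le
  have hLc := hL.continuous
  have hI : Integrable fun v : Vel N => Real.exp (-(‖v‖ - c₀)) :=
    integrable_exp_neg_of_norm_le (a := 1) (C := c₀) (by fun_prop) one_pos
      fun v => by rw [one_mul]
  have hIpos := integral_exp_pos hI
  set c := Real.log (∫ v : Vel N, Real.exp (-(‖v‖ - c₀))) with hcdef
  refine ⟨c, fun ε φ φbar l hε hε1 hp => ?_⟩
  set D := density L ε h φ φbar l with hD
  set θ : Torus N → ℝ := fun x => Real.exp (-((φbar x + φ x) / (ε * h))) with hθ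
  have hθc : Continuous θ := by fun_prop
  have hθi : Integrable θ :=
    integrableOn_univ.1 (hθc.continuousOn.integrableOn_compact isCompact_univ)
  have hfib (x : Torus N) : ∫ v : Vel N, Real.exp (-L x v - c) ≤ 1 := by
    have hLx : Continuous fun v => L x v := hL.continuous_comp continuous_const continuous_id
    have hi : Integrable fun v : Vel N => Real.exp (-L x v) :=
      integrable_exp_neg_of_norm_le (a := 1) (C := c₀) hLx one_pos
        fun v => by rw [one_mul]; exact hc₀ x v
    simp only [Real.exp_sub _ c]
    rw [integral_div, div_le_one (Real.exp_pos _), hcdef, Real.exp_log hIpos]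
    exact integral_mono hi hI fun v => Real.exp_le_exp.2 (neg_le_neg (hc₀ x v))
  have hgi : Integrable fun p : Torus N × Vel N => θ p.1 * Real.exp (-L p.1 p.2 - c) := by
    have hi : Integrable fun p : Torus N × Vel N => Real.exp (-(L p.1 p.2 + c)) :=
      integrable_exp_neg_prod (a := 1) (C := c₀ - c) (by fun_prop) one_pos
        fun p => by linarith [hc₀ p.1 p.2]
    simp only [neg_add'] at hi
    obtain ⟨M, hM⟩ := isCompact_univ.exists_bound_of_continuousOn hθc.continuousOn
    exact hi.bdd_mul (hθc.comp continuous_fst).aestronglyMeasurable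
      (.of_forall fun p => hM p.1 trivial)
  have hgle : ∫ p : Torus N × Vel N, θ p.1 * Real.exp (-L p.1 p.2 - c) ≤ 1 := by
    refine le_of_le_of_eq ?_ hp.normalized
    rw [Measure.volume_eq_prod, integral_prod _ hgi]
    refine integral_mono hgi.integral_prod_left hθi fun x => ?_
    simp only [integral_const_mul]
    exact mul_le_of_le_one_right (Real.exp_pos _).le (hfib x)
  obtain ⟨hai, ha⟩ := integral_action_mul_density hL hh hε hp
  have hLi := hL.integrable_mul_density (φ := φ) (φbar := φbar) (l := l) hh hε
  have hDi := hL.integrable_density (φ := φ) (φbar := φbar) (l := l) hh hε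
  rw [← hD] at hai ha hLi hDi
  -- Gibbs' inequality, from `log t ≤ t - 1` at the ratio of the two transition densities.
  have hpt (p : Torus N × Vel N) :
      ((h * L p.1 p.2 + φ (p.1 + proj (h • p.2)) - φ p.1 - l) / (ε * h)) * D p - L p.1 p.2 * D p
        - c * D p ≤ θ p.1 * Real.exp (-L p.1 p.2 - c) - D p := by
    set a := (h * L p.1 p.2 + φ (p.1 + proj (h • p.2)) - φ p.1 - l) / (ε * h) with hadef
    have hDp : D p = θ p.1 * Real.exp (-a) := rfl
    have h1 := Real.add_one_le_exp (a - L p.1 p.2 - c)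
    have h2 : θ p.1 * Real.exp (-L p.1 p.2 - c) = D p * Real.exp (a - L p.1 p.2 - c) := by
      rw [hDp, mul_assoc, ← Real.exp_add (-a),
        show -a + (a - L p.1 p.2 - c) = -L p.1 p.2 - c by ring]
    have h3 : 0 < D p := density_pos p
    rw [h2]
    nlinarith [mul_le_mul_of_nonneg_left h1 h3.le]
  have hmono := integral_mono ((hai.sub hLi).sub (hDi.const_mul c)) (hgi.sub hDi) hpt
  simp only [Pi.sub_apply] at hmono
  have e1 := integral_sub (hai.sub hLi) (hDi.const_mul c)
  simp only [Pi.sub_apply] at e1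
  rw [e1, integral_sub hai hLi, integral_sub hgi hDi,
    integral_const_mul, ha, hD, integral_density hL hh hε hp, ← hD] at hmono
  have hcv : criticalValue L h ≤ ∫ p : Torus N × Vel N, L p.1 p.2 * D p :=
    csInf_le (bddBelow_actions hL h) (integral_mem_actions hL hh hε hp)
  set J := ∫ p : Torus N × Vel N, L p.1 p.2 * D p
  have h4 : J / ε - l / (ε * h) - J - c * 1 ≤ 0 := by linarith
  have h5 := mul_le_mul_of_nonneg_left h4 hε.le
  have h6 : ε * (J / ε - l / (ε * h) - J - c * 1) = (1 - ε) * J - l / h - ε * c := by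
    field_simp
    ring
  have h7 := mul_le_mul_of_nonneg_left hcv (by linarith : 0 ≤ 1 - ε)
  linarith

end Measure

/-! ### Limits of the fixed points -/

section Limits

variable {L : Torus N → Vel N → ℝ} {h : ℝ} {ι : Type*} {l : Filter ι} {e : ι → ℝ}
  {φ φbar : ℝ → C(Torus N, ℝ)} {lam : ℝ → ℝ} {φh φbarh : C(Torus N, ℝ)}

lemma tendstoUniformly_const_add_comp {X Y : Type*} [TopologicalSpace X] [CompactSpace X]
    {f : ι → C(X, ℝ)} {g : C(X, ℝ)} (hf : Tendsto f l (𝓝 g)) (a : Y → ℝ) (q : Y → X) :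
    TendstoUniformly (fun i y => a y + f i (q y)) (fun y => a y + g (q y)) l := by
  refine Metric.tendstoUniformly_iff.2 fun δ hδ => ?_
  filter_upwards [Metric.tendstoUniformly_iff.1
    (ContinuousMap.tendsto_iff_tendstoUniformly.1 hf) δ hδ] with i hi y
  rw [dist_add_left]
  exact hi (q y)

lemma tendsto_mul_const_nhdsGT_zero (he : Tendsto e l (𝓝[>] 0)) (hh : 0 < h) :
    Tendsto (fun i => e i * h) l (𝓝[>] 0) := by
  rw [tendsto_nhdsWithin_iff] at he ⊢
  refine ⟨by simpa using he.1.mul_const h, ?_⟩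
  filter_upwards [he.2] with i hi
  exact mul_pos hi hh

/-- The eigenvalues converge to `h H̄_h`. For the upper bound, a holonomic measure of nearly minimal
action charges a point `(x, v)` where `h L + φ_h (x + hv) - φ_h (x)` is at most `h` times its
action, and Laplace's principle applies at this single point. -/
lemma tendsto_eigenvalue (hL : IsLagrangian L) (hh : 0 < h)
    (hp : ∀ ε : ℝ, 0 < ε → IsNormalizedFixedPair L ε h (φ ε) (φbar ε) (lam ε))
    (he : Tendsto e l (𝓝[>] 0)) (hφ : Tendsto (fun i => φ (e i)) l (𝓝 φh)) :
    Tendsto (fun i => lam (e i)) l (𝓝 (h * criticalValue L h)) := by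
  have he' := he.mono_right nhdsWithin_le_nhds
  have hpos : ∀ᶠ i in l, 0 < e i := he.eventually self_mem_nhdsWithin
  refine tendsto_order.2 ⟨fun a ha => ?_, fun b hb => ?_⟩
  · obtain ⟨c, hc⟩ := exists_forall_criticalValue_le hL hh
    have hlim : Tendsto (fun i => h * ((1 - e i) * criticalValue L h - e i * c)) l
        (𝓝 (h * criticalValue L h)) := by
      simpa using
        (((he'.const_sub 1).mul_const (criticalValue L h)).sub (he'.mul_const c)).const_mul h
    filter_upwards [hlim.eventually (lt_mem_nhds ha), hpos,
      he'.eventually (gt_mem_nhds zero_lt_one)] with i hi h0 h1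
    have h2 := mul_le_mul_of_nonneg_left (hc _ _ _ _ h0 h1.le (hp _ h0)) hh.le
    have h3 : h * (lam (e i) / h + e i * c) = lam (e i) + h * (e i * c) := by field_simp
    rw [h3] at h2
    linarith
  · set δ := (b - h * criticalValue L h) / 4 with hδ
    have hδ0 : 0 < δ := by rw [hδ]; linarith
    have hlt : criticalValue L h < criticalValue L h + δ / h :=
      lt_add_of_pos_right _ (by positivity)
    obtain ⟨_, ⟨μ, hμ, hLi, rfl⟩, ha⟩ := exists_lt_of_csInf_lt
      ⟨_, integral_mem_actions hL hh one_pos (hp 1 one_pos)⟩ hlt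
    have := hμ.isProbabilityMeasure
    have hφi : Integrable (fun p : Torus N × Vel N => φh (p.1 + proj (h • p.2)) - φh p.1) μ := by
      refine (integrable_const (‖φh‖ + ‖φh‖)).mono'
        (Continuous.aestronglyMeasurable (by fun_prop)) (.of_forall fun p => ?_)
      exact (norm_sub_le _ _).trans
        (add_le_add (φh.norm_coe_le_norm _) (φh.norm_coe_le_norm _))
    obtain ⟨p, hpt⟩ := exists_le_integral ((hLi.const_mul h).add hφi)
    simp only [Pi.add_apply] at hpt
    rw [integral_add (hLi.const_mul h) hφi, integral_const_mul, hμ.holonomic, add_zero] at hpt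
    have hha : h * ∫ p, L p.1 p.2 ∂μ < h * criticalValue L h + δ := by
      have := mul_lt_mul_of_pos_left ha hh
      rwa [mul_add, mul_div_cancel₀ _ hh.ne'] at this
    have hLp : Continuous fun v => L p.1 v := hL.continuous_comp continuous_const continuous_id
    have hlap := eventually_neg_mul_log_integral_exp_le (ν := (volume : Measure (Vel N)))
      (tendsto_mul_const_nhdsGT_zero he hh) (by fun_prop)
      (tendstoUniformly_const_add_comp hφ (fun v : Vel N => h * L p.1 v)
        (fun v => p.1 + proj (h • v)))
      (hpos.mono fun i hi => hL.integrable_exp_neg_div hh (mul_pos hi hh) _ (p := fun _ => p.1)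
        (by fun_prop) (by fun_prop)) p.2 hδ0
    have hev := ((continuous_eval_const p.1).tendsto φh).comp hφ
    filter_upwards [hlap, hpos, hev.eventually (lt_mem_nhds (sub_lt_self _ hδ0))] with i h1 h2 h3
    have h4 := (hp _ h2).forward p.1
    rw [opG] at h4
    simp only [Function.comp_apply] at h3
    rw [h4] at h1
    linarith

lemma isGLB_range_sub_const {Y : Type*} {G : Y → ℝ} {a b : ℝ} (hG : IsGLB (Set.range G) (a + b)) :
    IsGLB (Set.range fun y => G y - b) a := by
  refine ⟨?_, fun m hm => ?_⟩
  · rintro _ ⟨y, rfl⟩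
    linarith [hG.1 ⟨y, rfl⟩]
  · have : m + b ≤ a + b := hG.2 (by rintro _ ⟨y, rfl⟩; linarith [hm ⟨y, rfl⟩])
    linarith

lemma isCalibratedForward_of_tendsto [l.NeBot] (hL : IsLagrangian L) (hh : 0 < h)
    (hp : ∀ ε : ℝ, 0 < ε → IsNormalizedFixedPair L ε h (φ ε) (φbar ε) (lam ε))
    (he : Tendsto e l (𝓝[>] 0)) (hφ : Tendsto (fun i => φ (e i)) l (𝓝 φh)) :
    IsCalibratedForward L h φh := by
  intro x
  have hpos : ∀ᶠ i in l, 0 < e i := he.eventually self_mem_nhdsWithin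
  have hLx : Continuous fun v => L x v := hL.continuous_comp continuous_const continuous_id
  have hG1 := hL.integrable_exp_neg_div hh one_pos φh (p := fun _ => x)
    (q := fun v => x + proj (h • v)) (by fun_prop) (by fun_prop)
  simp only [div_one] at hG1
  have hglb := isGLB_of_tendsto_neg_mul_log_integral_exp (ν := (volume : Measure (Vel N)))
    (c := φh x + h * criticalValue L h)
    (tendsto_mul_const_nhdsGT_zero he hh) (by fun_prop)
    (tendstoUniformly_const_add_comp hφ (fun v : Vel N => h * L x v)
      (fun v => x + proj (h • v)))
    (hpos.mono fun i hi => hL.integrable_exp_neg_div hh (mul_pos hi hh) _ (p := fun _ => x)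
      (by fun_prop) (by fun_prop)) hG1 (by
      have hlim := (((continuous_eval_const x).tendsto φh).comp hφ).add
        (tendsto_eigenvalue hL hh hp he hφ)
      refine hlim.congr' ?_
      filter_upwards [hpos] with i hi
      exact ((hp _ hi).forward x).symm)
  simpa only [add_comm (h * L x _)] using isGLB_range_sub_const hglb

lemma isCalibratedBackward_of_tendsto [l.NeBot] (hL : IsLagrangian L) (hh : 0 < h)
    (hp : ∀ ε : ℝ, 0 < ε → IsNormalizedFixedPair L ε h (φ ε) (φbar ε) (lam ε))
    (he : Tendsto e l (𝓝[>] 0)) (hφ : Tendsto (fun i => φ (e i)) l (𝓝 φh))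
    (hφbar : Tendsto (fun i => φbar (e i)) l (𝓝 φbarh)) :
    IsCalibratedBackward L h φbarh := by
  intro x
  have hpos : ∀ᶠ i in l, 0 < e i := he.eventually self_mem_nhdsWithin
  have hLx : Continuous fun v => L (x - proj (h • v)) v :=
    hL.continuous_comp (by fun_prop) continuous_id
  have hG1 := hL.integrable_exp_neg_div hh one_pos φbarh (p := fun v => x - proj (h • v))
    (q := fun v => x - proj (h • v)) (by fun_prop) (by fun_prop)
  simp only [div_one] at hG1
  have hglb := isGLB_of_tendsto_neg_mul_log_integral_exp (ν := (volume : Measure (Vel N)))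
    (c := φbarh x + h * criticalValue L h)
    (tendsto_mul_const_nhdsGT_zero he hh) ((hLx.const_mul h).add (by fun_prop))
    (tendstoUniformly_const_add_comp hφbar (fun v : Vel N => h * L (x - proj (h • v)) v)
      (fun v => x - proj (h • v)))
    (hpos.mono fun i hi => hL.integrable_exp_neg_div hh (mul_pos hi hh) _
      (p := fun v => x - proj (h • v)) (by fun_prop) (by fun_prop)) hG1 (by
      have hlim := (((continuous_eval_const x).tendsto φbarh).comp hφbar).add
        (tendsto_eigenvalue hL hh hp he hφ)
      refine hlim.congr' ?_
      filter_upwards [hpos] with i hi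
      exact ((hp _ hi).backward x).symm)
  simpa only [Pi.add_apply, add_comm (h * L _ _)] using isGLB_range_sub_const hglb

/-- In the limit, the normalization of `φ̄ + φ` becomes `min (φ̄_h + φ_h) = 0`. -/
lemma isGLB_add_of_tendsto [l.NeBot] (hh : 0 < h)
    (hp : ∀ ε : ℝ, 0 < ε → IsNormalizedFixedPair L ε h (φ ε) (φbar ε) (lam ε))
    (he : Tendsto e l (𝓝[>] 0)) (hφ : Tendsto (fun i => φ (e i)) l (𝓝 φh))
    (hφbar : Tendsto (fun i => φbar (e i)) l (𝓝 φbarh)) :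
    IsGLB (Set.range fun x => φbarh x + φh x) 0 := by
  have hpos : ∀ᶠ i in l, 0 < e i := he.eventually self_mem_nhdsWithin
  have hint {g : Torus N → ℝ} (hg : Continuous g) : Integrable g :=
    integrableOn_univ.1 (hg.continuousOn.integrableOn_compact isCompact_univ)
  refine isGLB_of_tendsto_neg_mul_log_integral_exp (ν := (volume : Measure (Torus N)))
    (F := fun i x => φbar (e i) x + φ (e i) x)
    (tendsto_mul_const_nhdsGT_zero he hh) (by fun_prop) ?_
    (.of_forall fun i => hint (by fun_prop)) (hint (by fun_prop)) ?_
  · exact (ContinuousMap.tendsto_iff_tendstoUniformly.1 hφbar).add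
      (ContinuousMap.tendsto_iff_tendstoUniformly.1 hφ)
  · refine tendsto_const_nhds.congr' ?_
    filter_upwards [hpos] with i hi
    rw [(hp _ hi).normalized, Real.log_one, mul_zero]

lemma tendstoUniformly_penalizedRate (hL : IsLagrangian L) (hh : 0 < h)
    (hp : ∀ ε : ℝ, 0 < ε → IsNormalizedFixedPair L ε h (φ ε) (φbar ε) (lam ε))
    (he : Tendsto e l (𝓝[>] 0)) (hφ : Tendsto (fun i => φ (e i)) l (𝓝 φh))
    (hφbar : Tendsto (fun i => φbar (e i)) l (𝓝 φbarh)) :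
    TendstoUniformly
      (fun i p => penalizedRate L (e i) h (φ (e i)) (φbar (e i)) (lam (e i)) p)
      (rate L h φh φbarh) l := by
  refine Metric.tendstoUniformly_iff.2 fun δ hδ => ?_
  set η := h * δ / 3 with hη
  have hη0 : 0 < η := by positivity
  filter_upwards [he.eventually self_mem_nhdsWithin,
    eventually_forall_abs_sub_lt (ContinuousMap.tendsto_iff_tendstoUniformly.1 hφ) hη0,
    eventually_forall_abs_sub_lt (ContinuousMap.tendsto_iff_tendstoUniformly.1 hφbar) hη0,
    Metric.tendsto_nhds.1 (tendsto_eigenvalue hL hh hp he hφ) η hη0] with i h0 h1 h2 h3 p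
  have h0 : 0 < e i := h0
  have h1 := abs_lt.1 (h1 (p.1 + proj (h • p.2)))
  have h2 := abs_lt.1 (h2 p.1)
  rw [Real.dist_eq] at h3
  have h3 := abs_lt.1 h3
  have heq : rate L h φh φbarh p -
      penalizedRate L (e i) h (φ (e i)) (φbar (e i)) (lam (e i)) p =
      (-(φbar (e i) p.1 - φbarh p.1) - (φ (e i) (p.1 + proj (h • p.2)) -
        φh (p.1 + proj (h • p.2))) + (lam (e i) - h * criticalValue L h)) / h := by
    rw [rate, penalizedRate, penalizedAction_eq hL hh h0 (hp _ h0)]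
    field_simp
    ring
  rw [Real.dist_eq, heq, abs_div, abs_of_pos hh, div_lt_iff₀ hh, abs_lt]
  have h4 : δ * h = 3 * η := by rw [hη]; ring
  rw [h4]
  exact ⟨by linarith, by linarith⟩

lemma largeDeviationBounds_of_tendsto {ι : Type} {l : Filter ι} {e : ι → ℝ}
    (hL : IsLagrangian L) (hh : 0 < h)
    (hp : ∀ ε : ℝ, 0 < ε → IsNormalizedFixedPair L ε h (φ ε) (φbar ε) (lam ε))
    (he : Tendsto e l (𝓝[>] 0)) (hφ : Tendsto (fun i => φ (e i)) l (𝓝 φh))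
    (hφbar : Tendsto (fun i => φbar (e i)) l (𝓝 φbarh)) :
    LargeDeviationBounds l e
      (fun i => entropyMeasure L (e i) h (φ (e i)) (φbar (e i)) (lam (e i)))
      (rate L h φh φbarh) := by
  have hLc := hL.continuous
  have hcont : Continuous (rate L h φh φbarh) := by unfold rate; fun_prop
  have hunif := tendstoUniformly_penalizedRate hL hh hp he hφ hφbar
  have hμ (A : Set (Torus N × Vel N)) : (fun i => (e i : EReal) * ENNReal.log
      (entropyMeasure L (e i) h (φ (e i)) (φbar (e i)) (lam (e i)) A)) =ᶠ[l] fun i =>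
      (e i : EReal) * ENNReal.log (∫⁻ p in A, ENNReal.ofReal (Real.exp
        (-(penalizedRate L (e i) h (φ (e i)) (φbar (e i)) (lam (e i)) p / e i)))) := by
    filter_upwards [he.eventually self_mem_nhdsWithin] with i hi
    rw [entropyMeasure_apply hL hh hi (hp _ hi)]
  refine ⟨fun A hA hAb => ?_, fun A hA _ => ?_⟩
  · rw [limsup_congr (hμ A)]
    exact limsup_mul_log_setLIntegral_exp_le he hcont hunif
      (Metric.isCompact_of_isClosed_isBounded hA hAb)
  · rw [liminf_congr (hμ A)]
    exact le_liminf_mul_log_setLIntegral_exp he hcont hunif hA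

/-- Under uniqueness of the calibrated subactions up to constants, the limit does not depend on the
sequence: the two constants are fixed by `φ_h (0) = 0` and `min (φ̄_h + φ_h) = 0`. -/
lemma limit_unique (hL : IsLagrangian L) (hh : 0 < h)
    (hp : ∀ ε : ℝ, 0 < ε → IsNormalizedFixedPair L ε h (φ ε) (φbar ε) (lam ε))
    (huf : UniqueUpToConst (IsCalibratedForward L h))
    (hub : UniqueUpToConst (IsCalibratedBackward L h)) {e e' : ℕ → ℝ}
    {u ubar u' ubar' : C(Torus N, ℝ)}
    (he : Tendsto e atTop (𝓝[>] 0)) (hu : Tendsto (fun i => φ (e i)) atTop (𝓝 u))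
    (hubar : Tendsto (fun i => φbar (e i)) atTop (𝓝 ubar))
    (he' : Tendsto e' atTop (𝓝[>] 0)) (hu' : Tendsto (fun i => φ (e' i)) atTop (𝓝 u'))
    (hubar' : Tendsto (fun i => φbar (e' i)) atTop (𝓝 ubar')) : u = u' ∧ ubar = ubar' := by
  have hzero {e : ℕ → ℝ} {u : C(Torus N, ℝ)} (he : Tendsto e atTop (𝓝[>] 0))
      (hu : Tendsto (fun i => φ (e i)) atTop (𝓝 u)) : u 0 = 0 := by
    refine tendsto_nhds_unique (((continuous_eval_const 0).tendsto u).comp hu)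
      (tendsto_const_nhds.congr' ?_)
    filter_upwards [he.eventually self_mem_nhdsWithin] with i hi
    exact (hp _ hi).zero.symm
  obtain ⟨c, hc⟩ := huf u u' (isCalibratedForward_of_tendsto hL hh hp he hu)
    (isCalibratedForward_of_tendsto hL hh hp he' hu')
  have hc0 : c = 0 := by
    have := hc 0
    rw [hzero he hu, hzero he' hu'] at this
    linarith
  have huu : u = u' := ContinuousMap.ext fun x => by rw [hc x, hc0, add_zero]
  refine ⟨huu, ?_⟩
  obtain ⟨d, hd⟩ := hub ubar ubar' (isCalibratedBackward_of_tendsto hL hh hp he hu hubar)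
    (isCalibratedBackward_of_tendsto hL hh hp he' hu' hubar')
  have h1 := isGLB_add_of_tendsto hh hp he hu hubar
  have h2 := isGLB_add_of_tendsto hh hp he' hu' hubar'
  have h3 := isGLB_range_sub_const (G := fun x => ubar x + u x) (a := -d) (b := d)
    (by rwa [neg_add_cancel])
  have h4 : (fun x => ubar x + u x - d) = fun x => ubar' x + u' x := by
    funext x; rw [hd x, huu]; ring
  rw [h4] at h3
  have hd0 : -d = 0 := h3.unique h2
  exact ContinuousMap.ext fun x => by rw [hd x, neg_eq_zero.1 hd0, add_zero]

lemma exists_subseq_tendsto (hL : IsLagrangian L) (hh : 0 < h)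
    (hp : ∀ ε : ℝ, 0 < ε → IsNormalizedFixedPair L ε h (φ ε) (φbar ε) (lam ε)) {e : ℕ → ℝ}
    (he : Tendsto e atTop (𝓝[>] 0)) :
    ∃ (s : ℕ → ℕ) (φh φbarh : C(Torus N, ℝ)), StrictMono s ∧
      Tendsto (fun k => φ (e (s k))) atTop (𝓝 φh) ∧
      Tendsto (fun k => φbar (e (s k))) atTop (𝓝 φbarh) := by
  obtain ⟨S, hS, hmem⟩ := exists_isCompact_of_isNormalizedFixedPair hL hh
  have hev : ∀ᶠ k in atTop, (φ (e k), φbar (e k)) ∈ S ×ˢ S := by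
    filter_upwards [he.eventually self_mem_nhdsWithin] with k hk
    exact hmem _ _ _ _ hk (hp _ hk)
  obtain ⟨a, -, s, hs, hlim⟩ := (hS.prod hS).tendsto_subseq' hev.frequently
  exact ⟨s, a.1, a.2, hs, hlim.fst_nhds, hlim.snd_nhds⟩

end Limits

end EntropyMather

end

theorem mainTheorem2 {N : ℕ} (L : EntropyMather.Torus N → EntropyMather.Vel N → ℝ)
    (hL : EntropyMather.IsLagrangian L) (h : ℝ) (hh : 0 < h)
    (φ φbar : ℝ → C(EntropyMather.Torus N, ℝ)) (lam : ℝ → ℝ)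
    (hφ : ∀ ε : ℝ, 0 < ε →
      EntropyMather.IsNormalizedFixedPair L ε h (φ ε) (φbar ε) (lam ε)) :
    -- `μ_{ε,h}(A) = ∫_A exp (-f_{ε,h} / ε) dx dv`
    (∀ ε : ℝ, 0 < ε → ∀ A : Set (EntropyMather.Torus N × EntropyMather.Vel N), MeasurableSet A →
      EntropyMather.entropyMeasure L ε h (φ ε) (φbar ε) (lam ε) A =
        ∫⁻ p in A, ENNReal.ofReal (Real.exp
          (-(EntropyMather.penalizedRate L ε h (φ ε) (φbar ε) (lam ε) p / ε)))) ∧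
    -- every sequence `ε_k → 0+` has a subsequence along which the fixed points converge uniformly
    (∀ e : ℕ → ℝ, Tendsto e atTop (𝓝[>] 0) →
      ∃ (s : ℕ → ℕ) (φh φbarh : C(EntropyMather.Torus N, ℝ)), StrictMono s ∧
        Tendsto (fun k => φ (e (s k))) atTop (𝓝 φh) ∧
        Tendsto (fun k => φbar (e (s k))) atTop (𝓝 φbarh)) ∧
    -- the bounds along every sequence for which the fixed points converge uniformly
    (∀ (e : ℕ → ℝ) (φh φbarh : C(EntropyMather.Torus N, ℝ)), Tendsto e atTop (𝓝[>] 0) →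
      Tendsto (fun k => φ (e k)) atTop (𝓝 φh) →
      Tendsto (fun k => φbar (e k)) atTop (𝓝 φbarh) →
      EntropyMather.LargeDeviationBounds atTop e
        (fun k => EntropyMather.entropyMeasure L (e k) h (φ (e k)) (φbar (e k)) (lam (e k)))
        (EntropyMather.rate L h φh φbarh)) ∧
    -- the bounds as `ε → 0+`, when calibrated subactions are unique up to constants
    (EntropyMather.UniqueUpToConst (EntropyMather.IsCalibratedForward L h) →
      EntropyMather.UniqueUpToConst (EntropyMather.IsCalibratedBackward L h) →
      ∃ φh φbarh : C(EntropyMather.Torus N, ℝ),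
        Tendsto φ (𝓝[>] 0) (𝓝 φh) ∧ Tendsto φbar (𝓝[>] 0) (𝓝 φbarh) ∧
        EntropyMather.LargeDeviationBounds (𝓝[>] (0 : ℝ)) (fun ε => ε)
          (fun ε => EntropyMather.entropyMeasure L ε h (φ ε) (φbar ε) (lam ε))
          (EntropyMather.rate L h φh φbarh)) := by
  refine ⟨fun ε hε A _ => EntropyMather.entropyMeasure_apply hL hh hε (hφ ε hε) A,
    fun e he => EntropyMather.exists_subseq_tendsto hL hh hφ he,
    fun e φh φbarh he h1 h2 =>
      EntropyMather.largeDeviationBounds_of_tendsto hL hh hφ he h1 h2,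
    fun huf hub => ?_⟩
  have he : Tendsto (fun n : ℕ => 1 / ((n : ℝ) + 1)) atTop (𝓝[>] 0) :=
    tendsto_nhdsWithin_iff.2 ⟨tendsto_one_div_add_atTop_nhds_zero_nat,
      .of_forall fun _ => Set.mem_Ioi.2 Nat.one_div_pos_of_nat⟩
  obtain ⟨s, φh, φbarh, hs, h1, h2⟩ := EntropyMather.exists_subseq_tendsto hL hh hφ he
  have key : ∀ ns : ℕ → ℝ, Tendsto ns atTop (𝓝[>] 0) → ∃ ms : ℕ → ℕ,
      Tendsto (fun n => φ (ns (ms n))) atTop (𝓝 φh) ∧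
      Tendsto (fun n => φbar (ns (ms n))) atTop (𝓝 φbarh) := by
    intro ns hns
    obtain ⟨ms, u, ubar, hms, h3, h4⟩ := EntropyMather.exists_subseq_tendsto hL hh hφ hns
    obtain ⟨rfl, rfl⟩ := EntropyMather.limit_unique hL hh hφ huf hub
      (hns.comp hms.tendsto_atTop) h3 h4 (he.comp hs.tendsto_atTop) h1 h2
    exact ⟨ms, h3, h4⟩
  have l1 : Tendsto φ (𝓝[>] 0) (𝓝 φh) := tendsto_of_subseq_tendsto fun ns hns =>
    (key ns hns).imp fun _ hm => hm.1
  have l2 : Tendsto φbar (𝓝[>] 0) (𝓝 φbarh) := tendsto_of_subseq_tendsto fun ns hns =>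
    (key ns hns).imp fun _ hm => hm.2
  exact ⟨φh, φbarh, l1, l2,
    EntropyMather.largeDeviationBounds_of_tendsto hL hh hφ tendsto_id l1 l2⟩
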